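/- **Theorem (differential privacy of Thompson Sampling with Gaussian prior).** Consider a bandit with a fixed finite number $K\ge 1$ of arms and rewards in $[0,1]$. Thompson Sampling with Gaussian prior works as follows: in each round, if arm $i$ was played $k_i$ times so far with total observed reward $s_i$, draw independently $\theta_i\sim\mathcal N\big(\hat u_i,\tfrac1{k_i+1}\big)$ for all arms $i$, play an arm $a_t$ with maximal $\theta_i$, and observe the reward of that arm only. Here $\hat u_i=s_i/(k_i+1)$ is the mean of the Gaussian posterior; the theorem is also asserted for the variant in which $\hat u_i$ is the empirical mean $s_i/k_i$ (and $0$ if $k_i=0$). A bandit algorithm is $(\varepsilon,\delta)$-differentially private up to round $T$ if for any two sequences $r,r'$ of reward vectors ($r_t\in[0,1]^K$ contains the rewards of all arms in round $t$) that differ in at most one round, and for every set $S\subseteq\{1,\dots,K\}^T$ of action sequences, $$\mathbb P\big[(a_1,\dots,a_T)\in S\mid r\big]\le e^{\varepsilon}\,\mathbb P\big[(a_1,\dots,a_T)\in S\mid r'\big]+\delta .$$ Then Thompson Sampling with Gaussian prior, without any modification, is $\mathcal O(\varepsilon,\delta)$-differentially private up to round $T$ with $\varepsilon=\ln^2T$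 and $\delta=T^{-4}$: for every $K$ there is a constant $C>0$ such that, for every $T\ge1$, it is $(C\ln^2 T,\;C\,T^{-4})$-differentially private up to round $T$. -/

import Mathlib

open MeasureTheory ProbabilityTheory

noncomputable section

/-- A (randomized) bandit algorithm with `K` arms: to every finite history of pairs
(arm played, reward received) it assigns the law of the next arm to be played. -/
structure BanditAlgorithm (K : ℕ) where
  /-- law of the next arm given the first `t` (action, reward) pairs -/
  policy : (t : ℕ) → (Fin t → Fin K × ℝ) → PMF (Fin K)

/-- The law of the sequence of the first `t` arms played by the algorithm on the reward
table `r`, where `r s i` is the reward of arm `i` in round `s` (rounds are numbered from `0`).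
In each round the algorithm only sees the rewards of the arms that it has played. -/
def BanditAlgorithm.actions {K : ℕ} (A : BanditAlgorithm K) (r : ℕ → Fin K → ℝ) :
    (t : ℕ) → PMF (Fin t → Fin K)
  | 0 => PMF.pure Fin.elim0
  | t + 1 => (A.actions r t).bind fun a =>
      (A.policy t fun s => (a s, r s (a s))).map fun i => Fin.snoc (α := fun _ => Fin K) a i

/-- Two reward tables differ in at most one round (in that round the rewards of all arms
may differ). -/
def DifferInAtMostOneRound {K : ℕ} (r r' : ℕ → Fin K → ℝ) : Prop :=
  ∃ s : ℕ, ∀ t : ℕ, t ≠ s → r t = r' t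

/-- `(ε, δ)`-differential privacy of a bandit algorithm up to round `T`, rewards in `[0, 1]`:
for any two reward tables that differ in at most one round, the laws of the whole sequence
of the first `T` actions are `(ε, δ)`-indistinguishable. -/
def BanditAlgorithm.IsDifferentiallyPrivate {K : ℕ} (A : BanditAlgorithm K) (T : ℕ)
    (ε δ : ℝ) : Prop :=
  ∀ r r' : ℕ → Fin K → ℝ,
    (∀ t i, r t i ∈ Set.Icc (0 : ℝ) 1) → (∀ t i, r' t i ∈ Set.Icc (0 : ℝ) 1) →
    DifferInAtMostOneRound r r' →
    ∀ S : Set (Fin T → Fin K),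
      (A.actions r T).toMeasure S ≤
        ENNReal.ofReal (Real.exp ε) * (A.actions r' T).toMeasure S + ENNReal.ofReal δ

open Classical in
/-- The set of maximizers of `θ`. -/
def maximizers {K : ℕ} (θ : Fin K → ℝ) : Finset (Fin K) :=
  Finset.univ.filter fun i => ∀ j, θ j ≤ θ i

theorem mem_maximizers {K : ℕ} (θ : Fin K → ℝ) (i : Fin K) :
    i ∈ maximizers θ ↔ ∀ j, θ j ≤ θ i := by
  simp [maximizers]

theorem maximizers_nonempty {K : ℕ} [NeZero K] (θ : Fin K → ℝ) : (maximizers θ).Nonempty := by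
  obtain ⟨i, hi⟩ := Finite.exists_max θ
  exact ⟨i, (mem_maximizers θ i).2 hi⟩

/-- An index at which `θ` is maximal (the smallest one if there are several; under the
continuous laws below ties have probability zero). -/
def argmax {K : ℕ} [NeZero K] (θ : Fin K → ℝ) : Fin K :=
  (maximizers θ).min' (maximizers_nonempty θ)

theorem argmax_eq_iff {K : ℕ} [NeZero K] (θ : Fin K → ℝ) (i : Fin K) :
    argmax θ = i ↔ (∀ j, θ j ≤ θ i) ∧ ∀ j, j < i → θ j < θ i := by
  unfold argmax
  rw [Finset.min'_eq_iff]
  simp only [mem_maximizers]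
  refine and_congr_right fun hi => ⟨fun h j hj => ?_, fun h b hb => ?_⟩
  · by_contra hlt
    exact absurd (h j fun l => (hi l).trans (not_lt.mp hlt)) (not_le.mpr hj)
  · by_contra hlt
    exact absurd (h b (not_le.mp hlt)) (not_lt.mpr (hb i))

theorem measurable_argmax {K : ℕ} [NeZero K] :
    Measurable (argmax : (Fin K → ℝ) → Fin K) := by
  refine measurable_to_countable' fun i => ?_
  have h : (argmax : (Fin K → ℝ) → Fin K) ⁻¹' {i} =
      (⋂ j, {θ | θ j ≤ θ i}) ∩ ⋂ j, ⋂ (_ : j < i), {θ | θ j < θ i} := by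
    ext θ
    simp [argmax_eq_iff]
  rw [h]
  refine (MeasurableSet.iInter fun j => ?_).inter
    (MeasurableSet.iInter fun j => MeasurableSet.iInter fun _ => ?_)
  · exact measurableSet_le (measurable_pi_apply j) (measurable_pi_apply i)
  · exact measurableSet_lt (measurable_pi_apply j) (measurable_pi_apply i)

/-- `k_i`: the number of times arm `i` was played. -/
def pulls {K t : ℕ} (h : Fin t → Fin K × ℝ) (i : Fin K) : ℕ :=
  (Finset.univ.filter fun s => (h s).1 = i).card

/-- The sum of the rewards received from arm `i`. -/
def rewardSum {K t : ℕ} (h : Fin t → Fin K × ℝ) (i : Fin K) : ℝ :=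
  ∑ s ∈ Finset.univ.filter fun s => (h s).1 = i, (h s).2

/-- The two forms in which the center `û_i` of the Gaussian samples occurs: the mean of the
posterior for the prior `N(0, 1)`, and the plain empirical mean. -/
inductive MeanRule where
  | posterior
  | empirical

/-- The center `û_i` of the Gaussian sample for arm `i`: with `k_i` plays and reward sum `s_i`
it is `s_i / (k_i + 1)` for the posterior mean, and `s_i / k_i` (initial value `0` if `k_i = 0`)
for the empirical mean. -/
def armMean (m : MeanRule) {K t : ℕ} (h : Fin t → Fin K × ℝ) (i : Fin K) : ℝ :=
  match m with
  | .posterior => rewardSum h i / ((pulls h i : ℝ) + 1)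
  | .empirical => if pulls h i = 0 then 0 else rewardSum h i / (pulls h i : ℝ)

/-- The joint law of the independent samples `θ_i ∼ N(û_i, 1 / (k_i + 1))`. -/
def thompsonSamples (m : MeanRule) {K t : ℕ} (h : Fin t → Fin K × ℝ) :
    Measure (Fin K → ℝ) :=
  Measure.pi fun i => gaussianReal (armMean m h i) ((pulls h i : NNReal) + 1)⁻¹

instance (m : MeanRule) {K t : ℕ} (h : Fin t → Fin K × ℝ) :
    IsProbabilityMeasure (thompsonSamples m h) := by
  unfold thompsonSamples
  infer_instance

instance (m : MeanRule) {K t : ℕ} [NeZero K] (h : Fin t → Fin K × ℝ) :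
    IsProbabilityMeasure ((thompsonSamples m h).map argmax) :=
  Measure.isProbabilityMeasure_map measurable_argmax.aemeasurable

/-- Thompson Sampling with Gaussian prior: in each round draw `θ_i ∼ N(û_i, 1 / (k_i + 1))`
independently for all arms, and play the arm with the largest sample. -/
def thompsonSampling (m : MeanRule) (K : ℕ) [NeZero K] : BanditAlgorithm K where
  policy _ h := ((thompsonSamples m h).map argmax).toPMF

end

noncomputable section

/-! Fix the changed round `s`, and let `i` be the arm played in it. Along a common action sequence
the histories agree until the reward of round `s` is seen. Afterwards only the Gaussian of arm `i`
differs: after `k` plays its variance is 1/(k+1), and its two centers are at distance at most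
2/(k+1). Hence the laws p, q of the next arm have ratios bounded by a constant R depending only on
`K` (`right_real_le_ratioBound_mul`), and |q - p| ≤ D(σp + 1/T) with σ² ≤ ln T / k
(`exists_abs_sub_le`).

Charging σ in every round would be too expensive, since `k` may stay small for a long time. However,
moving the center of `i` moves the probabilities of all other arms in the same direction. So ∑|q -
p| ≤ 2|q_i - p_i|, and the χ² distance is of order σ²p_i + 1/T: the loss is proportional to the
chance of playing `i`. Each play of `i` thus pays about ln T / k, and the harmonic sum over plays is
of order ln² T.

This amortization is carried by the moment E[(P/P')^l W] of the likelihood ratio, where W is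
`discount`. By `sum_mul_div_rpow_mul_le` it grows by a factor 1 + O(1/T) per round, hence stays
bounded. Since W ≥ exp(-ln T (1 + ln T)), Markov's inequality (`toMeasure_actions_le`) gives privacy
once e^{lε} dominates both 1/W and T⁴. -/

/-! ### Gaussian tails, lower bounds and density ratios. -/

theorem gaussianReal_hasSubgaussianMGF_sub (μ : ℝ) (v : NNReal) :
    HasSubgaussianMGF (fun x => x - μ) v (gaussianReal μ v) where
  integrable_exp_mul t := by
    have h := (integrable_exp_mul_gaussianReal (μ := μ) (v := v) t).mul_const (Real.exp (-(t * μ)))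
    refine h.congr (ae_of_all _ fun x => ?_)
    simp only [← Real.exp_add]
    ring_nf
  mgf_le t := by
    have h : (gaussianReal μ v).map (fun x => x - μ) = gaussianReal 0 v := by
      rw [gaussianReal_map_sub_const, sub_self]
    rw [mgf_gaussianReal h]
    simp

theorem gaussianReal_real_le_sub (μ : ℝ) (v : NNReal) {u : ℝ} (hu : 0 ≤ u) :
    (gaussianReal μ v).real {x | u ≤ x - μ} ≤ Real.exp (-u ^ 2 / (2 * v)) :=
  (gaussianReal_hasSubgaussianMGF_sub μ v).measure_ge_le hu

theorem gaussianReal_real_le_sub' (μ : ℝ) (v : NNReal) {u : ℝ} (hu : 0 ≤ u) :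
    (gaussianReal μ v).real {x | u ≤ μ - x} ≤ Real.exp (-u ^ 2 / (2 * v)) := by
  have h := (gaussianReal_hasSubgaussianMGF_sub μ v).neg.measure_ge_le hu
  simpa using h

theorem gaussianReal_real_le_abs_sub (μ : ℝ) (v : NNReal) {u : ℝ} (hu : 0 ≤ u) :
    (gaussianReal μ v).real {x | u ≤ |x - μ|} ≤ 2 * Real.exp (-u ^ 2 / (2 * v)) := by
  have h : {x | u ≤ |x - μ|} ⊆ {x | u ≤ x - μ} ∪ {x | u ≤ μ - x} := by
    intro x hx
    rcases le_abs.1 (show u ≤ |x - μ| from hx) with h | h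
    · exact Or.inl h
    · exact Or.inr (by simpa using h)
  have h1 := measureReal_mono (μ := gaussianReal μ v) h
  have h2 := measureReal_union_le (μ := gaussianReal μ v) {x | u ≤ x - μ} {x | u ≤ μ - x}
  linarith [gaussianReal_real_le_sub μ v hu, gaussianReal_real_le_sub' μ v hu]

theorem gaussianReal_real_lt_abs_sub_midpoint_le {μ μ' : ℝ} (v : NNReal) {τ u : ℝ} (hu : 0 ≤ u)
    (huτ : u + |μ' - μ| / 2 ≤ τ) :
    (gaussianReal μ' v).real {x | τ < |x - (μ + μ') / 2|} ≤ 2 * Real.exp (-u ^ 2 / (2 * v)) := by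
  refine le_trans (measureReal_mono fun x hx => ?_) (gaussianReal_real_le_abs_sub μ' v hu)
  have hx : τ < |x - (μ + μ') / 2| := hx
  show u ≤ |x - μ'|
  have e : x - (μ + μ') / 2 = (x - μ') + (μ' - μ) / 2 := by ring
  have h1 := abs_add_le (x - μ') ((μ' - μ) / 2)
  rw [← e, abs_div, abs_two] at h1
  linarith

theorem exp_neg_two_le_half : Real.exp (-2) ≤ 1 / 2 := by
  have := Real.add_one_le_exp (2 : ℝ)
  rw [Real.exp_neg, one_div]
  exact inv_anti₀ (by norm_num) (by linarith)

theorem exp_neg_sq_div_le_half {v : NNReal} (hv : v ≠ 0) (hv1 : v ≤ 1) :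
    Real.exp (-(2 : ℝ) ^ 2 / (2 * v)) ≤ 1 / 2 := by
  refine le_trans (Real.exp_le_exp.2 ?_) exp_neg_two_le_half
  have h0 : (0 : ℝ) < v := by positivity
  have h1 : (v : ℝ) ≤ 1 := by exact_mod_cast hv1
  rw [div_le_iff₀ (by positivity)]
  linarith

theorem half_le_gaussianReal_Iio {μ : ℝ} {v : NNReal} (hv : v ≠ 0) (hv1 : v ≤ 1) (hμ : μ ≤ 1) :
    1 / 2 ≤ (gaussianReal μ v).real (Set.Iio 3) := by
  have h := gaussianReal_real_le_sub μ v (u := 2) (by norm_num)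
  have h1 : (Set.Iio (3 : ℝ))ᶜ ⊆ {x | 2 ≤ x - μ} := by
    intro x hx
    simp only [Set.mem_compl_iff, Set.mem_Iio, not_lt, Set.mem_ofPred_eq] at hx ⊢
    linarith
  have h2 := measureReal_mono (μ := gaussianReal μ v) h1
  rw [probReal_compl_eq_one_sub measurableSet_Iio] at h2
  linarith [exp_neg_sq_div_le_half hv hv1]

theorem half_le_gaussianReal_Ioi {μ : ℝ} {v : NNReal} (hv : v ≠ 0) (hv1 : v ≤ 1) (hμ : 0 ≤ μ) :
    1 / 2 ≤ (gaussianReal μ v).real (Set.Ioi (-2)) := by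
  have h := gaussianReal_real_le_sub' μ v (u := 2) (by norm_num)
  have h1 : (Set.Ioi (-2 : ℝ))ᶜ ⊆ {x | 2 ≤ μ - x} := by
    intro x hx
    simp only [Set.mem_compl_iff, Set.mem_Ioi, not_lt, Set.mem_ofPred_eq] at hx ⊢
    linarith
  have h2 := measureReal_mono (μ := gaussianReal μ v) h1
  rw [probReal_compl_eq_one_sub measurableSet_Ioi] at h2
  linarith [exp_neg_sq_div_le_half hv hv1]

/-- The exponent contributes at least -8/v, and the normalization at least e⁻¹ ≥ e^{-1/v} because v
≤ 1. -/
theorem exp_le_gaussianPDFReal {μ x : ℝ} {v : NNReal} (hv : v ≠ 0) (hv1 : v ≤ 1)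
    (hx : |x - μ| ≤ 4) : Real.exp (-9 / v) ≤ gaussianPDFReal μ v x := by
  have h0 : (0 : ℝ) < v := by positivity
  have h1 : (v : ℝ) ≤ 1 := by exact_mod_cast hv1
  have hs : √(2 * Real.pi * v) ≤ Real.exp 1 := by
    rw [Real.sqrt_le_left (Real.exp_pos 1).le]
    have := Real.pi_lt_d2
    have := Real.exp_one_gt_d9
    nlinarith [Real.pi_pos]
  have hs0 : 0 < √(2 * Real.pi * v) := Real.sqrt_pos.2 (by positivity)
  have hi : Real.exp (-1) ≤ (√(2 * Real.pi * v))⁻¹ := by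
    rw [Real.exp_neg]
    exact inv_anti₀ hs0 hs
  have hq : -8 / (v : ℝ) ≤ -(x - μ) ^ 2 / (2 * v) := by
    rw [div_le_div_iff₀ h0 (by positivity)]
    have : (x - μ) ^ 2 ≤ 16 := by
      have := sq_le_sq' (by linarith [abs_nonneg (x - μ)]) hx
      rw [sq_abs] at this
      linarith
    nlinarith
  calc Real.exp (-9 / v) ≤ Real.exp (-1 + -8 / v) := by
        refine Real.exp_le_exp.2 ?_
        have : 1 ≤ 1 / (v : ℝ) := by rw [le_div_iff₀ h0]; linarith
        have e : -9 / (v : ℝ) = -(1 / v) + -8 / v := by ring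
        linarith
    _ = Real.exp (-1) * Real.exp (-8 / v) := Real.exp_add _ _
    _ ≤ _ := by
        unfold gaussianPDFReal
        gcongr

theorem exp_le_gaussianReal_Icc {μ a : ℝ} {v : NNReal} (hv : v ≠ 0) (hv1 : v ≤ 1)
    (h1 : μ - 4 ≤ a) (h2 : a ≤ μ + 3) :
    Real.exp (-9 / v) ≤ (gaussianReal μ v).real (Set.Icc a (a + 1)) := by
  rw [measureReal_def, gaussianReal_apply_eq_integral μ hv,
    ENNReal.toReal_ofReal (integral_nonneg fun x => gaussianPDFReal_nonneg μ v x)]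
  have hi : ∫ _ in Set.Icc a (a + 1), Real.exp (-9 / v) = Real.exp (-9 / v) := by
    simp
  rw [← hi]
  refine setIntegral_mono_on (by simp) (integrable_gaussianPDFReal μ v).integrableOn
    measurableSet_Icc fun x hx => exp_le_gaussianPDFReal hv hv1 ?_
  rw [abs_le]
  constructor <;> linarith [hx.1, hx.2]

/-- The logarithm of the density ratio is (μ' - μ)(x - (μ + μ')/2)/v. A shift of order v cancels the
variance, so the ratio is controlled by the distance to the midpoint alone. -/
theorem gaussianPDFReal_le_exp_mul {μ μ' x τ : ℝ} {v : NNReal} (hv : v ≠ 0)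
    (hμ : |μ' - μ| ≤ 2 * v) (hx : |x - (μ + μ') / 2| ≤ τ) :
    gaussianPDFReal μ' v x ≤ Real.exp (2 * τ) * gaussianPDFReal μ v x := by
  have h0 : (0 : ℝ) < v := by positivity
  unfold gaussianPDFReal
  rw [mul_left_comm, ← Real.exp_add]
  gcongr
  have h : (μ' - μ) * (x - (μ + μ') / 2) ≤ 2 * v * τ := by
    refine (le_abs_self _).trans ?_
    rw [abs_mul]
    gcongr
  have e : 2 * τ + -(x - μ) ^ 2 / (2 * v) = (2 * v * τ * 2 - (x - μ) ^ 2) / (2 * v) := by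
    field_simp
    ring
  rw [e]
  gcongr
  nlinarith

theorem integrable_of_mem_Icc {α : Type*} [MeasurableSpace α] {μ : Measure α} [IsFiniteMeasure μ]
    {f : α → ℝ} (hf : Measurable f) (h0 : ∀ x, 0 ≤ f x) (h1 : ∀ x, f x ≤ 1) : Integrable f μ :=
  Integrable.of_bound hf.aestronglyMeasurable 1
    (ae_of_all _ fun x => by rw [Real.norm_of_nonneg (h0 x)]; exact h1 x)

/-- The tail term keeps `f` instead of bounding it by 1: the multiplicative bound on the probability
of an arm needs the tail weighted by `f`. -/
theorem integral_gaussianReal_le {μ μ' τ : ℝ} {v : NNReal} (hv : v ≠ 0)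
    (hμ : |μ' - μ| ≤ 2 * v) {f : ℝ → ℝ} (hf : Measurable f) (h0 : ∀ x, 0 ≤ f x)
    (h1 : ∀ x, f x ≤ 1) :
    ∫ x, f x ∂gaussianReal μ' v ≤ Real.exp (2 * τ) * ∫ x, f x ∂gaussianReal μ v +
      ∫ x in {x | τ < |x - (μ + μ') / 2|}, f x ∂gaussianReal μ' v := by
  have hm : MeasurableSet {x : ℝ | τ < |x - (μ + μ') / 2|} :=
    measurableSet_lt measurable_const (by fun_prop)
  have hint : ∀ m, Integrable (fun x => gaussianPDFReal m v x * f x) := fun m => by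
    refine (integrable_gaussianPDFReal m v).mul_bdd (c := 1) hf.aestronglyMeasurable
      (ae_of_all _ fun x => ?_)
    rw [Real.norm_of_nonneg (h0 x)]
    exact h1 x
  rw [← integral_indicator hm, integral_gaussianReal_eq_integral_smul hv,
    integral_gaussianReal_eq_integral_smul hv, integral_gaussianReal_eq_integral_smul hv,
    ← integral_const_mul]
  simp only [smul_eq_mul]
  have hint' : Integrable (fun x => gaussianPDFReal μ' v x *
      ({x : ℝ | τ < |x - (μ + μ') / 2|}.indicator f x)) := by
    refine ((hint μ').indicator hm).congr (ae_of_all _ fun x => ?_)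
    by_cases hx : x ∈ {x : ℝ | τ < |x - (μ + μ') / 2|} <;> simp [hx]
  rw [← integral_add ((hint μ).const_mul _) hint']
  refine integral_mono (hint μ') (((hint μ).const_mul _).add hint') fun x => ?_
  by_cases hx : τ < |x - (μ + μ') / 2|
  · have : 0 ≤ Real.exp (2 * τ) * (gaussianPDFReal μ v x * f x) :=
      mul_nonneg (Real.exp_pos _).le (mul_nonneg (gaussianPDFReal_nonneg _ _ _) (h0 x))
    simp only [Set.indicator, Set.mem_ofPred_eq, hx, if_true]
    linarith
  · have := mul_le_mul_of_nonneg_right (gaussianPDFReal_le_exp_mul hv hμ (not_lt.1 hx)) (h0 x)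
    simp only [Set.indicator, Set.mem_ofPred_eq, hx, if_false, mul_zero, add_zero]
    linarith

theorem integral_gaussianReal_antitone {μ μ' : ℝ} (v : NNReal) (hμ : μ ≤ μ') {f : ℝ → ℝ}
    (hf : Measurable f) (h0 : ∀ x, 0 ≤ f x) (h1 : ∀ x, f x ≤ 1) (ha : Antitone f) :
    ∫ x, f x ∂gaussianReal μ' v ≤ ∫ x, f x ∂gaussianReal μ v := by
  have h : gaussianReal μ' v = (gaussianReal μ v).map (fun x => x + (μ' - μ)) := by
    rw [gaussianReal_map_add_const]; congr 1; ring
  rw [h, integral_map (by fun_prop) hf.aestronglyMeasurable]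
  refine integral_mono (integrable_of_mem_Icc (by fun_prop) (fun x => h0 _) fun x => h1 _)
    (integrable_of_mem_Icc hf h0 h1) fun x => ha (by linarith)

/-! ### The argmax as a function of a single sample. -/

/-- Resampling one coordinate of a product measure gives the product measure with the new
marginal in that coordinate. -/
theorem pi_prod_map_update {ι : Type*} [Fintype ι] [DecidableEq ι] {α : ι → Type*}
    [∀ i, MeasurableSpace (α i)] {g g' : ∀ i, Measure (α i)} [∀ i, IsProbabilityMeasure (g i)]
    [∀ i, IsProbabilityMeasure (g' i)] {i : ι} (hg : ∀ j, j ≠ i → g' j = g j) :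
    ((Measure.pi g).prod (g' i)).map (fun z => Function.update z.1 i z.2) = Measure.pi g' := by
  have hm : Measurable fun z : (∀ j, α j) × α i => Function.update z.1 i z.2 := by
    refine measurable_pi_iff.2 fun j => ?_
    by_cases h : j = i
    · subst h
      simpa using measurable_snd
    · simp only [Function.update_of_ne h]
      exact (measurable_pi_apply j).comp measurable_fst
  refine (Measure.pi_eq fun s hs => ?_).symm
  rw [Measure.map_apply hm (MeasurableSet.univ_pi hs)]
  have h : (fun z : (∀ j, α j) × α i => Function.update z.1 i z.2) ⁻¹' Set.pi Set.univ s =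
      (Set.pi Set.univ (Function.update s i Set.univ)) ×ˢ s i := by
    ext z
    simp only [Set.mem_preimage, Set.mem_univ_pi, Set.mem_prod]
    constructor
    · refine fun h => ⟨fun j => ?_, by simpa using h i⟩
      by_cases hj : j = i
      · subst hj; simp
      · simpa [hj] using h j
    · rintro ⟨h1, h2⟩ j
      by_cases hj : j = i
      · subst hj; simpa using h2
      · simpa [hj] using h1 j
  rw [h, Measure.prod_prod, Measure.pi_pi, ← Finset.mul_prod_erase _ _ (Finset.mem_univ i),
    ← Finset.mul_prod_erase _ (fun j => g' j (s j)) (Finset.mem_univ i)]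
  simp only [Function.update_self, measure_univ, one_mul]
  rw [mul_comm]
  congr 1
  refine Finset.prod_congr rfl fun j hj => ?_
  rw [Function.update_of_ne (Finset.ne_of_mem_erase hj), hg j (Finset.ne_of_mem_erase hj)]

theorem measurable_update_prod {K : ℕ} (i : Fin K) :
    Measurable fun z : (Fin K → ℝ) × ℝ => Function.update z.1 i z.2 := by
  refine measurable_pi_iff.2 fun j => ?_
  by_cases h : j = i
  · subst h
    simpa using measurable_snd
  · simp only [Function.update_of_ne h]
    exact (measurable_pi_apply j).comp measurable_fst

/-- The probability that `a` is the argmax of independent samples, given that the sample of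
`i` is `x`. -/
def argmaxProb {K : ℕ} [NeZero K] (g : Fin K → Measure ℝ) (i a : Fin K) (x : ℝ) : ℝ :=
  (Measure.pi g).real {θ | argmax (Function.update θ i x) = a}

section argmaxProb

variable {K : ℕ} [NeZero K]

theorem measurableSet_argmax_update (i a : Fin K) :
    MeasurableSet {z : (Fin K → ℝ) × ℝ | argmax (Function.update z.1 i z.2) = a} :=
  (measurable_argmax.comp (measurable_update_prod i)) (measurableSet_singleton a)

variable (g : Fin K → Measure ℝ) (i a : Fin K)

theorem argmaxProb_nonneg (x : ℝ) : 0 ≤ argmaxProb g i a x := measureReal_nonneg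

variable [∀ i, IsProbabilityMeasure (g i)]

theorem measurable_argmaxProb : Measurable (argmaxProb g i a) :=
  (measurable_measure_prodMk_right (measurableSet_argmax_update i a)).ennreal_toReal

theorem argmaxProb_le_one (x : ℝ) : argmaxProb g i a x ≤ 1 := measureReal_le_one

variable {g}

theorem pi_real_argmax_eq_integral {g' : Fin K → Measure ℝ} [∀ i, IsProbabilityMeasure (g' i)]
    {i : Fin K} (hg : ∀ j, j ≠ i → g' j = g j) (a : Fin K) :
    (Measure.pi g').real (argmax ⁻¹' {a}) = ∫ x, argmaxProb g i a x ∂g' i := by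
  have hs := measurableSet_argmax_update i a
  rw [← pi_prod_map_update hg, measureReal_def, Measure.map_apply (measurable_update_prod i)
    (measurable_argmax (measurableSet_singleton a))]
  have e : (fun z : (Fin K → ℝ) × ℝ => Function.update z.1 i z.2) ⁻¹' (argmax ⁻¹' {a}) =
    {z : (Fin K → ℝ) × ℝ | argmax (Function.update z.1 i z.2) = a} := rfl
  rw [e, Measure.prod_apply_symm hs, integral_eq_lintegral_of_nonneg_ae
    (ae_of_all _ (argmaxProb_nonneg g i a)) (measurable_argmaxProb g i a).aestronglyMeasurable]
  congr 1
  refine lintegral_congr fun x => ?_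
  rw [argmaxProb, ofReal_measureReal]
  rfl

variable {i a}

theorem argmax_update_of_le {θ : Fin K → ℝ} (hai : a ≠ i) {x y : ℝ} (hxy : x ≤ y)
    (h : argmax (Function.update θ i y) = a) : argmax (Function.update θ i x) = a := by
  rw [argmax_eq_iff] at h ⊢
  simp only [Function.update_of_ne hai] at h ⊢
  refine ⟨fun j => ?_, fun j hj => ?_⟩
  · have := h.1 j
    by_cases hji : j = i
    · subst hji; simp only [Function.update_self] at this ⊢; linarith
    · simpa only [Function.update_of_ne hji] using this
  · have := h.2 j hj
    by_cases hji : j = i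
    · subst hji; simp only [Function.update_self] at this ⊢; linarith
    · simpa only [Function.update_of_ne hji] using this

theorem antitone_argmaxProb (g : Fin K → Measure ℝ) [∀ i, IsProbabilityMeasure (g i)]
    (hai : a ≠ i) : Antitone (argmaxProb g i a) :=
  fun _ _ hxy => measureReal_mono fun _ hθ => argmax_update_of_le hai hxy hθ

theorem half_pow_le_argmaxProb_self (hg : ∀ j, 1 / 2 ≤ (g j).real (Set.Iio 3)) {x : ℝ}
    (hx : 3 ≤ x) : (1 / 2 : ℝ) ^ K ≤ argmaxProb g i i x := by
  have hsub : Set.pi Set.univ (fun _ : Fin K => Set.Iio (3 : ℝ)) ⊆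
      {θ | argmax (Function.update θ i x) = i} := by
    intro θ hθ
    simp only [Set.mem_univ_pi, Set.mem_Iio] at hθ
    show argmax _ = i
    rw [argmax_eq_iff]
    simp only [Function.update_self]
    refine ⟨fun j => ?_, fun j hj => ?_⟩
    · by_cases hji : j = i
      · subst hji; simp
      · rw [Function.update_of_ne hji]; linarith [hθ j]
    · rw [Function.update_of_ne hj.ne]; linarith [hθ j]
  refine le_trans ?_ (measureReal_mono hsub)
  rw [measureReal_def, Measure.pi_pi, ENNReal.toReal_prod]
  calc (1 / 2 : ℝ) ^ K = ∏ _j : Fin K, (1 / 2 : ℝ) := by simp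
    _ ≤ _ := Finset.prod_le_prod (fun _ _ => by norm_num) fun j _ => hg j

/-- Lowering the sample of `i` below -2 already gives `a` its full chance up to a factor 2, since
the sample of `a` itself exceeds -2 with probability at least 1/2. The sample of `a` is resampled
with all others frozen; `U θ w` is the set of its winning values when arm `i` shows `w`. -/
theorem argmaxProb_le_two_mul (hai : a ≠ i) (hg : 1 / 2 ≤ (g a).real (Set.Ioi (-2))) {x y : ℝ}
    (hy : y ≤ -2) : argmaxProb g i a x ≤ 2 * argmaxProb g i a y := by
  set U : (Fin K → ℝ) → ℝ → Set ℝ := fun θ w =>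
    {z | argmax (Function.update (Function.update θ a z) i w) = a} with hU
  have hmU : ∀ w, MeasurableSet {z : (Fin K → ℝ) × ℝ |
      argmax (Function.update (Function.update z.1 a z.2) i w) = a} := fun w => by
    have : Measurable fun z : (Fin K → ℝ) × ℝ =>
        argmax (Function.update (Function.update z.1 a z.2) i w) :=
      measurable_argmax.comp ((measurable_update_prod i).comp
        ((measurable_update_prod a).prodMk measurable_const))
    exact this (measurableSet_singleton a)
  have key : ∀ w, Measure.pi g {θ | argmax (Function.update θ i w) = a} =
      ∫⁻ θ, g a (U θ w) ∂Measure.pi g := fun w => by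
    have hms : MeasurableSet {θ : Fin K → ℝ | argmax (Function.update θ i w) = a} := by
      have : Measurable fun θ : Fin K → ℝ => argmax (Function.update θ i w) :=
        measurable_argmax.comp ((measurable_update_prod i).comp
          (measurable_id.prodMk measurable_const))
      exact this (measurableSet_singleton a)
    conv_lhs => rw [← pi_prod_map_update (g := g) (g' := g) (i := a) fun _ _ => rfl]
    rw [Measure.map_apply (measurable_update_prod a) hms]
    exact Measure.prod_apply (hmU w)
  have mem : ∀ θ w z, z ∈ U θ w ↔ w ≤ z ∧ (i < a → w < z) ∧
      (∀ j, j ≠ i → j ≠ a → θ j ≤ z) ∧ ∀ j, j ≠ i → j < a → θ j < z := by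
    intro θ w z
    simp only [hU, Set.mem_ofPred_eq]
    rw [argmax_eq_iff]
    simp only [Function.update_of_ne hai, Function.update_self]
    constructor
    · rintro ⟨h1, h2⟩
      refine ⟨by simpa using h1 i, fun h => by simpa using h2 i h, fun j hj hja => ?_,
        fun j hj hja => ?_⟩
      · simpa [hj, hja] using h1 j
      · simpa [hj, hja.ne] using h2 j hja
    · rintro ⟨h1, h2, h3, h4⟩
      refine ⟨fun j => ?_, fun j hja => ?_⟩
      · by_cases hj : j = i
        · subst hj; simpa using h1
        · by_cases hja : j = a
          · subst hja; simp [hj]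
          · simpa [hj, hja] using h3 j hj hja
      · by_cases hj : j = i
        · subst hj; simpa using h2 hja
        · simpa [hj, hja.ne] using h4 j hj hja
  have hU2 : ∀ θ, g a (U θ x) ≤ 2 * g a (U θ y) := by
    intro θ
    -- If some winning value is at most y ≤ -2, then all other competitors are below -2 and every
    -- value above -2 wins against y. Otherwise all values winning against x exceed y, so they also
    -- win against y.
    by_cases h : ∃ z ∈ U θ x, z ≤ y
    · obtain ⟨z, hz, hzy⟩ := h
      rw [mem] at hz
      have hsub : Set.Ioi (-2 : ℝ) ⊆ U θ y := by
        intro w hw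
        have hw : -2 < w := hw
        rw [mem]
        exact ⟨by linarith, fun _ => by linarith, fun j h1 h2 => by linarith [hz.2.2.1 j h1 h2],
          fun j h1 h2 => by linarith [hz.2.2.2 j h1 h2]⟩
      have h2 : 1 / 2 ≤ (g a).real (U θ y) := hg.trans (measureReal_mono hsub)
      have h3 : (g a).real (U θ x) ≤ 1 := measureReal_le_one
      have h4 : (g a).real (U θ x) ≤ 2 * (g a).real (U θ y) := by linarith
      rw [← ofReal_measureReal (μ := g a) (s := U θ x), ← ofReal_measureReal (μ := g a) (s := U θ y)]
      refine (ENNReal.ofReal_le_ofReal h4).trans ?_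
      rw [ENNReal.ofReal_mul (by norm_num)]
      simp
    · push Not at h
      have hsub : U θ x ⊆ U θ y := by
        intro z hz
        have := h z hz
        rw [mem] at hz ⊢
        exact ⟨this.le, fun _ => this, hz.2.2.1, hz.2.2.2⟩
      refine (measure_mono hsub).trans ?_
      exact le_mul_of_one_le_left (zero_le) (by norm_num)
  have h : Measure.pi g {θ | argmax (Function.update θ i x) = a} ≤
      2 * Measure.pi g {θ | argmax (Function.update θ i y) = a} := by
    rw [key, key, ← lintegral_const_mul' _ _ (by norm_num)]
    exact lintegral_mono hU2
  have := ENNReal.toReal_mono (ENNReal.mul_ne_top (by norm_num) (measure_ne_top _ _)) h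
  rw [ENNReal.toReal_mul] at this
  simpa [argmaxProb, measureReal_def] using this

end argmaxProb

/-! ### One round: how a shifted center changes the law of the argmax. -/

/-- The marginals `g` and `g'` of two families of samples differ in the arm `i` only, where they
are Gaussians of the same variance `v` with centers at distance at most `2 * v`. All samples are
of order one. -/
structure ShiftedMarginals {K : ℕ} (g g' : Fin K → Measure ℝ) (i : Fin K) (μ μ' : ℝ) (v : NNReal) :
    Prop where
  left_eq : g i = gaussianReal μ v
  right_eq : g' i = gaussianReal μ' v
  eq_of_ne : ∀ j, j ≠ i → g' j = g j
  half_left : ∀ j, 1 / 2 ≤ (g j).real (Set.Iio 3) ∧ 1 / 2 ≤ (g j).real (Set.Ioi (-2))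
  half_right : ∀ j, 1 / 2 ≤ (g' j).real (Set.Iio 3) ∧ 1 / 2 ≤ (g' j).real (Set.Ioi (-2))
  left_mem : μ ∈ Set.Icc (0 : ℝ) 1
  right_mem : μ' ∈ Set.Icc (0 : ℝ) 1
  var_ne_zero : v ≠ 0
  var_le : v ≤ 1
  dist_le : |μ' - μ| ≤ 2 * v

/-- The constant that bounds the ratio of the probabilities of playing an arm. -/
def ratioBound (K : ℕ) : ℝ := Real.exp 12 + 2 ^ K + 2

theorem one_le_ratioBound (K : ℕ) : 1 ≤ ratioBound K := by
  have := Real.exp_pos 12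
  have : (0 : ℝ) < 2 ^ K := by positivity
  unfold ratioBound
  linarith

namespace ShiftedMarginals

variable {K : ℕ} {g g' : Fin K → Measure ℝ} {i : Fin K} {μ μ' : ℝ} {v : NNReal}

theorem symm (h : ShiftedMarginals g g' i μ μ' v) : ShiftedMarginals g' g i μ' μ v where
  left_eq := h.right_eq
  right_eq := h.left_eq
  eq_of_ne j hj := (h.eq_of_ne j hj).symm
  half_left := h.half_right
  half_right := h.half_left
  left_mem := h.right_mem
  right_mem := h.left_mem
  var_ne_zero := h.var_ne_zero
  var_le := h.var_le
  dist_le := by rw [abs_sub_comm]; exact h.dist_le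

/-- The rate -9/v matches `exp_le_gaussianReal_Icc`: the tail beyond 6 is no likelier than a sample
in [3, 4] or in [-3, -2]. -/
theorem real_tail_six_le (h : ShiftedMarginals g g' i μ μ' v) :
    (gaussianReal μ' v).real {x | 6 < |x - (μ + μ') / 2|} ≤ Real.exp (-9 / v) := by
  have hv : (0 : ℝ) < v := NNReal.coe_pos.2 (pos_iff_ne_zero.2 h.var_ne_zero)
  have hv1 : (v : ℝ) ≤ 1 := by exact_mod_cast h.var_le
  have hd : |μ' - μ| ≤ 1 := by
    rw [abs_le]
    constructor <;> linarith [h.left_mem.1, h.left_mem.2, h.right_mem.1, h.right_mem.2]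
  refine (gaussianReal_real_lt_abs_sub_midpoint_le (μ := μ) (μ' := μ') v (u := 5)
    (by norm_num) (by linarith)).trans ?_
  have h2 : (2 : ℝ) ≤ Real.exp 1 := by linarith [Real.add_one_le_exp (1 : ℝ)]
  calc 2 * Real.exp (-5 ^ 2 / (2 * v)) ≤ Real.exp 1 * Real.exp (-5 ^ 2 / (2 * v)) := by gcongr
    _ = Real.exp (1 + -5 ^ 2 / (2 * v)) := (Real.exp_add _ _).symm
    _ ≤ _ := by
        refine Real.exp_le_exp.2 ?_
        have : 1 ≤ 1 / (v : ℝ) := by rw [le_div_iff₀ hv]; linarith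
        have e : (-5 ^ 2 / (2 * v) : ℝ) = -(25 / 2) * (1 / v) := by ring
        have e' : (-9 / v : ℝ) = -9 * (1 / v) := by ring
        rw [e, e']
        linarith

variable [NeZero K] [∀ i, IsProbabilityMeasure (g i)]

theorem left_real (h : ShiftedMarginals g g' i μ μ' v) (a : Fin K) :
    (Measure.pi g).real (argmax ⁻¹' {a}) = ∫ x, argmaxProb g i a x ∂gaussianReal μ v := by
  rw [← h.left_eq]
  exact pi_real_argmax_eq_integral (fun _ _ => rfl) a

theorem setIntegral_argmaxProb_le {M : ℝ} {a : Fin K} (hM : ∀ x, argmaxProb g i a x ≤ M) {s : Set ℝ}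
    (hs : MeasurableSet s) (m : ℝ) :
    ∫ x in s, argmaxProb g i a x ∂gaussianReal m v ≤ M * (gaussianReal m v).real s := by
  have : ∫ _ in s, M ∂gaussianReal m v = M * (gaussianReal m v).real s := by
    rw [setIntegral_const, smul_eq_mul, mul_comm]
  rw [← this]
  exact setIntegral_mono_on (integrable_of_mem_Icc (measurable_argmaxProb g i a)
    (argmaxProb_nonneg g i a) (argmaxProb_le_one g i a)).integrableOn (by simp) hs fun x _ => hM x

theorem le_left_real (h : ShiftedMarginals g g' i μ μ' v) {M b : ℝ} {a : Fin K}
    (hM : ∀ x ∈ Set.Icc b (b + 1), M ≤ argmaxProb g i a x) (hM0 : 0 ≤ M)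
    (h1 : μ - 4 ≤ b) (h2 : b ≤ μ + 3) :
    M * Real.exp (-9 / v) ≤ (Measure.pi g).real (argmax ⁻¹' {a}) := by
  rw [h.left_real]
  have hi : Integrable (argmaxProb g i a) (gaussianReal μ v) :=
    integrable_of_mem_Icc (measurable_argmaxProb g i a)
      (argmaxProb_nonneg g i a) (argmaxProb_le_one g i a)
  calc M * Real.exp (-9 / v) ≤ M * (gaussianReal μ v).real (Set.Icc b (b + 1)) :=
        mul_le_mul_of_nonneg_left (exp_le_gaussianReal_Icc h.var_ne_zero h.var_le h1 h2) hM0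
    _ = ∫ _ in Set.Icc b (b + 1), M ∂gaussianReal μ v := by
        rw [setIntegral_const, smul_eq_mul, mul_comm]
    _ ≤ ∫ x in Set.Icc b (b + 1), argmaxProb g i a x ∂gaussianReal μ v :=
        setIntegral_mono_on (by simp) hi.integrableOn measurableSet_Icc hM
    _ ≤ _ := setIntegral_le_integral hi (ae_of_all _ (argmaxProb_nonneg g i a))

variable [∀ i, IsProbabilityMeasure (g' i)]

theorem right_real (h : ShiftedMarginals g g' i μ μ' v) (a : Fin K) :
    (Measure.pi g').real (argmax ⁻¹' {a}) = ∫ x, argmaxProb g i a x ∂gaussianReal μ' v := by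
  rw [← h.right_eq]
  exact pi_real_argmax_eq_integral h.eq_of_ne a

theorem right_real_le (h : ShiftedMarginals g g' i μ μ' v) (a : Fin K) (τ : ℝ) :
    (Measure.pi g').real (argmax ⁻¹' {a}) ≤
      Real.exp (2 * τ) * (Measure.pi g).real (argmax ⁻¹' {a}) +
        ∫ x in {x | τ < |x - (μ + μ') / 2|}, argmaxProb g i a x ∂gaussianReal μ' v := by
  rw [h.left_real, h.right_real]
  exact integral_gaussianReal_le h.var_ne_zero h.dist_le (measurable_argmaxProb g i a)
    (argmaxProb_nonneg g i a) (argmaxProb_le_one g i a)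

/-- Within distance 6 of the midpoint the densities have ratio at most e¹². An additive tail error
would not do, as the probability of `a` may be far smaller than the tail; the tail contribution is
instead compared with an event for the sample of `i` under which `a` wins. -/
theorem right_real_le_ratioBound_mul (h : ShiftedMarginals g g' i μ μ' v) (a : Fin K) :
    (Measure.pi g').real (argmax ⁻¹' {a}) ≤
      ratioBound K * (Measure.pi g).real (argmax ⁻¹' {a}) := by
  have hms : MeasurableSet {x : ℝ | 6 < |x - (μ + μ') / 2|} :=
    measurableSet_lt measurable_const (by fun_prop)
  have ht := h.real_tail_six_le
  have h1 := h.right_real_le a 6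
  have hp : 0 ≤ (Measure.pi g).real (argmax ⁻¹' {a}) := measureReal_nonneg
  have hK : (0 : ℝ) < 2 ^ K := by positivity
  have he := Real.exp_pos (-9 / v : ℝ)
  obtain ⟨hμ0, hμ1⟩ := h.left_mem
  norm_num at h1
  unfold ratioBound
  by_cases hai : a = i
  · subst hai
    have h2 := setIntegral_argmaxProb_le (v := v) (argmaxProb_le_one g a a) hms μ'
    have h3 := h.le_left_real (a := a) (M := (1 / 2) ^ K) (b := 3)
      (fun x hx => half_pow_le_argmaxProb_self (fun j => (h.half_left j).1) hx.1) (by positivity)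
      (by linarith) (by linarith)
    have h4 : Real.exp (-9 / v) ≤ 2 ^ K * (Measure.pi g).real (argmax ⁻¹' {a}) := by
      have := mul_le_mul_of_nonneg_left h3 hK.le
      rwa [← mul_assoc, ← mul_pow, mul_one_div_cancel two_ne_zero, one_pow, one_mul] at this
    nlinarith
  -- The sample of `i` lies in [-3, -2] with probability at least e^{-9/v}, and there the chance of
  -- `a` is at least half its value at any x.
  · have hF : ∀ x, argmaxProb g i a x ≤
        2 * (Measure.pi g).real (argmax ⁻¹' {a}) / Real.exp (-9 / v) := fun x => by
      rw [le_div_iff₀ he]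
      have := h.le_left_real (a := a) (M := argmaxProb g i a x / 2) (b := -3)
        (fun y hy => by
          have := argmaxProb_le_two_mul (x := x) hai (h.half_left a).2 (y := y)
            (by linarith [hy.2])
          linarith)
        (by linarith [argmaxProb_nonneg g i a x]) (by linarith) (by linarith)
      linarith
    have h2 := setIntegral_argmaxProb_le (v := v) hF hms μ'
    have h3 : 2 * (Measure.pi g).real (argmax ⁻¹' {a}) / Real.exp (-9 / v) *
        (gaussianReal μ' v).real {x | 6 < |x - (μ + μ') / 2|} ≤
        2 * (Measure.pi g).real (argmax ⁻¹' {a}) := by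
      calc _ ≤ 2 * (Measure.pi g).real (argmax ⁻¹' {a}) / Real.exp (-9 / v) *
            Real.exp (-9 / v) := by gcongr
        _ = _ := div_mul_cancel₀ _ he.ne'
    nlinarith

theorem right_real_le_add (h : ShiftedMarginals g g' i μ μ' v) (a : Fin K) {τ : ℝ}
    (hτ : 2 * v ≤ τ) :
    (Measure.pi g').real (argmax ⁻¹' {a}) ≤
      Real.exp (2 * τ) * (Measure.pi g).real (argmax ⁻¹' {a}) +
        2 * Real.exp (-τ ^ 2 / (8 * v)) := by
  have hms : MeasurableSet {x : ℝ | τ < |x - (μ + μ') / 2|} :=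
    measurableSet_lt measurable_const (by fun_prop)
  have hv : (0 : ℝ) < v := NNReal.coe_pos.2 (pos_iff_ne_zero.2 h.var_ne_zero)
  have h1 := h.right_real_le a τ
  have h2 := setIntegral_argmaxProb_le (v := v) (argmaxProb_le_one g i a) hms μ'
  -- Half of τ absorbs the offset |μ' - μ|/2 ≤ v between center and midpoint.
  have h3 := gaussianReal_real_lt_abs_sub_midpoint_le (μ := μ) (μ' := μ') v (τ := τ)
    (u := τ / 2) (by linarith) (by linarith [h.dist_le])
  have e : -(τ / 2) ^ 2 / (2 * (v : ℝ)) = -τ ^ 2 / (8 * v) := by ring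
  rw [e] at h3
  linarith

/-- Raising the sample of `i` can only hurt the other arms; translating the Gaussian couples the two
laws. -/
theorem right_real_le_left_real (h : ShiftedMarginals g g' i μ μ' v) (hμ : μ ≤ μ') {a : Fin K}
    (ha : a ≠ i) :
    (Measure.pi g').real (argmax ⁻¹' {a}) ≤ (Measure.pi g).real (argmax ⁻¹' {a}) := by
  rw [h.left_real, h.right_real]
  exact integral_gaussianReal_antitone v hμ (measurable_argmaxProb g i a)
    (argmaxProb_nonneg g i a) (argmaxProb_le_one g i a) (antitone_argmaxProb g ha)

theorem exists_abs_sub_le (h : ShiftedMarginals g g' i μ μ' v) {k T : ℕ} (hk : 1 ≤ k)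
    (hv : (v : ℝ) = ((k : ℝ) + 1)⁻¹) (hT : 2 ≤ T) :
    ∃ s : ℝ, 0 ≤ s ∧ s ≤ 1 ∧ s ^ 2 ≤ Real.log T / k ∧ ∀ a,
      |(Measure.pi g').real (argmax ⁻¹' {a}) - (Measure.pi g).real (argmax ⁻¹' {a})| ≤
        6 * Real.exp 6 * ratioBound K *
          (s * (Measure.pi g).real (argmax ⁻¹' {a}) + (T : ℝ)⁻¹) := by
  have hR := one_le_ratioBound K
  have hk0 : (1 : ℝ) ≤ k := by exact_mod_cast hk
  have hT0 : (2 : ℝ) ≤ T := by exact_mod_cast hT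
  have hTi : 0 < (T : ℝ)⁻¹ := by positivity
  have h6 : 1 ≤ Real.exp 6 := Real.one_le_exp (by norm_num)
  have hL : 1 / 2 < Real.log T :=
    lt_of_lt_of_le (by linarith [Real.log_two_gt_d9]) (Real.log_le_log two_pos hT0)
  have hD : 0 ≤ 6 * Real.exp 6 * ratioBound K := by positivity
  have hDR : ratioBound K ≤ 6 * Real.exp 6 * ratioBound K :=
    le_mul_of_one_le_left (by linarith) (by linarith)
  -- For few plays the bounded ratio suffices, with s = 1. For many plays the density comparison is
  -- sharp enough.
  by_cases hkL : (k : ℝ) ≤ Real.log T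
  · refine ⟨1, zero_le_one, le_rfl, ?_, fun a => ?_⟩
    · rw [one_pow, le_div_iff₀ (by linarith)]
      linarith
    · have hp : 0 ≤ (Measure.pi g).real (argmax ⁻¹' {a}) := measureReal_nonneg
      have hp' : 0 ≤ (Measure.pi g').real (argmax ⁻¹' {a}) := measureReal_nonneg
      have h1 := h.right_real_le_ratioBound_mul a
      have h2 := mul_le_mul_of_nonneg_right hDR hp
      have h3 := mul_nonneg hD hTi.le
      have h4 := mul_le_mul_of_nonneg_right hR hp
      rw [abs_le]
      constructor <;> linarith
  · push Not at hkL
    set s := √(Real.log T / k) with hs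
    have hs2 : s ^ 2 = Real.log T / k := Real.sq_sqrt (by positivity)
    have hs0 : 0 ≤ s := Real.sqrt_nonneg _
    have hs1 : s ≤ 1 := by
      rw [hs, Real.sqrt_le_left zero_le_one, one_pow, div_le_one (by linarith)]
      exact hkL.le
    have hv0 : (0 : ℝ) < v := NNReal.coe_pos.2 (pos_iff_ne_zero.2 h.var_ne_zero)
    have hv2 : (v : ℝ) ≤ 1 / 2 := by
      rw [hv, inv_le_comm₀ (by linarith) (by norm_num)]
      norm_num
      linarith
    -- The factor 3 makes the tail exponent τ²/(8v) equal to (9/8) ln T, so the tail is at most 1/T.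
    set τ := 3 * √(Real.log T * v) with hτ
    have hτ0 : 0 ≤ τ := by positivity
    have hτ2 : τ ^ 2 = 9 * (Real.log T * v) := by
      rw [hτ, mul_pow, Real.sq_sqrt (by positivity)]
      norm_num
    have hτs : τ ≤ 3 * s := by
      rw [hτ, hs]
      gcongr
      rw [hv, div_eq_mul_inv]
      gcongr
      linarith
    have hτv : 2 * v ≤ τ := by
      refine abs_le_of_sq_le_sq' ?_ hτ0 |>.2
      rw [hτ2]
      nlinarith
    have htail : Real.exp (-τ ^ 2 / (8 * v)) ≤ (T : ℝ)⁻¹ := by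
      have e : -τ ^ 2 / (8 * v) = -(9 / 8 * Real.log T) := by
        rw [hτ2]
        field_simp
      rw [e, ← Real.exp_log (show (0 : ℝ) < T by linarith), ← Real.exp_neg, Real.log_exp]
      exact Real.exp_le_exp.2 (by linarith)
    have hexp : Real.exp (2 * τ) ≤ 1 + 6 * Real.exp 6 * s := by
      have h1 := Real.add_one_le_exp (-(2 * τ))
      have h2 : Real.exp (2 * τ) * Real.exp (-(2 * τ)) = 1 := by
        rw [← Real.exp_add, add_neg_cancel, Real.exp_zero]
      have h3 : Real.exp (2 * τ) ≤ Real.exp 6 := Real.exp_le_exp.2 (by linarith)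
      have h4 := mul_le_mul_of_nonneg_left h1 (Real.exp_pos (2 * τ)).le
      have h5 : Real.exp (2 * τ) * (2 * τ) ≤ Real.exp 6 * (6 * s) := by
        apply mul_le_mul h3 (by linarith) (by positivity) (by positivity)
      linarith
    refine ⟨s, hs0, hs1, hs2.le, fun a => ?_⟩
    have hp : 0 ≤ (Measure.pi g).real (argmax ⁻¹' {a}) := measureReal_nonneg
    have hp' : 0 ≤ (Measure.pi g').real (argmax ⁻¹' {a}) := measureReal_nonneg
    have h1 := h.right_real_le_add a hτv
    have h2 := h.symm.right_real_le_add a hτv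
    have h3 := h.right_real_le_ratioBound_mul a
    have h4 := mul_le_mul_of_nonneg_right hexp hp
    have h5 := mul_le_mul_of_nonneg_right hexp hp'
    have hA : 0 ≤ 6 * Real.exp 6 * s := by positivity
    have h6' := mul_le_mul_of_nonneg_left h3 hA
    have h7 : 6 * Real.exp 6 * s * (Measure.pi g).real (argmax ⁻¹' {a}) ≤
        6 * Real.exp 6 * s * (ratioBound K * (Measure.pi g).real (argmax ⁻¹' {a})) :=
      mul_le_mul_of_nonneg_left (le_mul_of_one_le_left hp hR) hA
    have h8 : 2 * (T : ℝ)⁻¹ ≤ 6 * Real.exp 6 * ratioBound K * (T : ℝ)⁻¹ := by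
      refine mul_le_mul_of_nonneg_right ?_ hTi.le
      nlinarith
    rw [abs_le]
    constructor <;> linarith

end ShiftedMarginals

/-! ### One-step inequality for moments of the likelihood ratio. -/

theorem exp_le_one_add_add_sq {y : ℝ} (hy : y ≤ 1) : Real.exp y ≤ 1 + y + y ^ 2 := by
  by_cases h : -1 ≤ y
  · have := (abs_le.1 (Real.abs_exp_sub_one_sub_id_le (abs_le.2 ⟨h, hy⟩))).2
    linarith
  · push Not at h
    have := Real.exp_le_one_iff.2 (show y ≤ 0 by linarith)
    nlinarith

/-- A second-order expansion of exp(l log(p/q)) whose linear term is exactly -l(q - p), so that it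
vanishes when summed over two probability vectors. -/
theorem mul_div_rpow_le {p q R l : ℝ} (hp : 0 ≤ p) (hq : 0 ≤ q) (hR : 1 ≤ R) (hpq : p ≤ R * q)
    (hqp : q ≤ R * p) (hl : 0 ≤ l) (hlR : l * R ≤ 1) :
    p * (p / q) ^ l ≤ p - l * (q - p) + 2 * l * R ^ 2 * ((q - p) ^ 2 / p) := by
  rcases hp.eq_or_lt with rfl | hp
  · have : q = 0 := by linarith
    simp [this]
  have hq : 0 < q := by
    rcases hq.eq_or_lt with rfl | h
    · linarith
    · exact h
  have hl1 : l ≤ 1 := by nlinarith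
  obtain ⟨x, hx⟩ : ∃ x, x = q / p := ⟨_, rfl⟩
  have hx0 : 0 < x := by rw [hx]; positivity
  have hqx : q = x * p := by rw [hx]; field_simp
  obtain ⟨z, hz⟩ : ∃ z, z = p / q := ⟨_, rfl⟩
  have hz0 : 0 < z := by rw [hz]; positivity
  have hzR : z ≤ R := by rw [hz, div_le_iff₀ hq]; exact hpq
  have hzx : z * x = 1 := by rw [hz, hx]; field_simp
  have hlog1 : Real.log z ≤ z - 1 := Real.log_le_sub_one_of_pos hz0
  have hlog2 : -Real.log z ≤ x - 1 := by
    have : -Real.log z = Real.log x := by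
      rw [← Real.log_inv, eq_comm, inv_eq_of_mul_eq_one_right hzx]
    rw [this]
    exact Real.log_le_sub_one_of_pos hx0
  have hz1 : z - 1 = -(x - 1) + z * (x - 1) ^ 2 := by linear_combination (2 - x) * hzx
  have hz2 : z - 1 = z * (1 - x) := by linear_combination hzx
  have hsq : Real.log z ^ 2 ≤ R ^ 2 * (x - 1) ^ 2 := by
    rw [← mul_pow]
    rcases le_total x 1 with h | h
    · have h1 := mul_le_mul_of_nonneg_right hzR (sub_nonneg.2 h)
      have e : R * (x - 1) = -(R * (1 - x)) := by ring
      rw [e, neg_sq]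
      exact pow_le_pow_left₀ (by linarith) (by linarith) 2
    · have h1 := mul_nonneg hz0.le (sub_nonneg.2 h)
      have h2 := mul_le_mul_of_nonneg_right hR (sub_nonneg.2 h)
      rw [← neg_sq (Real.log z)]
      exact pow_le_pow_left₀ (by linarith) (by linarith) 2
  have hle : Real.log z ≤ -(x - 1) + R * (x - 1) ^ 2 := by
    have := mul_le_mul_of_nonneg_right hzR (sq_nonneg (x - 1))
    linarith
  have hy : l * Real.log z ≤ 1 := by
    refine le_trans (mul_le_mul_of_nonneg_left ?_ hl) hlR
    linarith
  have hexp := exp_le_one_add_add_sq hy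
  have hpow : (p / q) ^ l = Real.exp (l * Real.log z) := by
    rw [← hz, Real.rpow_def_of_pos hz0, mul_comm]
  have hmain : (p / q) ^ l ≤ 1 - l * (x - 1) + 2 * l * R ^ 2 * (x - 1) ^ 2 := by
    rw [hpow]
    have h1 := mul_le_mul_of_nonneg_left hle hl
    have h2 := mul_le_mul_of_nonneg_left hsq (sq_nonneg l)
    have h3 : l ^ 2 * (R ^ 2 * (x - 1) ^ 2) ≤ l * (R ^ 2 * (x - 1) ^ 2) := by
      refine mul_le_mul_of_nonneg_right ?_ (by positivity)
      nlinarith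
    have h4 : l * (R * (x - 1) ^ 2) ≤ l * (R ^ 2 * (x - 1) ^ 2) := by
      gcongr
      nlinarith
    nlinarith
  calc p * (p / q) ^ l ≤ p * (1 - l * (x - 1) + 2 * l * R ^ 2 * (x - 1) ^ 2) := by gcongr
    _ = _ := by
      rw [hqx]
      field_simp

/-- Guarantees that the discount at the distinguished arm saves a fixed fraction of p, even after
weighting by the likelihood ratio. -/
theorem div_le_mul_div_rpow {p q R l : ℝ} (hp : 0 ≤ p) (hq : 0 ≤ q) (hR : 1 ≤ R)
    (hpq : p ≤ R * q) (hqp : q ≤ R * p) (hl : 0 ≤ l) (hl1 : l ≤ 1) :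
    p / R ≤ p * (p / q) ^ l := by
  rcases hp.eq_or_lt with rfl | hp
  · simp
  have hq : 0 < q := by
    rcases hq.eq_or_lt with rfl | h
    · linarith
    · exact h
  rw [div_eq_mul_inv]
  gcongr
  have h1 : R⁻¹ ≤ p / q := by
    rw [inv_le_comm₀ (by linarith) (by positivity), inv_div, div_le_iff₀ hp]
    exact hqp
  have hR0 : 0 < R⁻¹ := by positivity
  calc R⁻¹ = R⁻¹ ^ (1 : ℝ) := (Real.rpow_one _).symm
    _ ≤ R⁻¹ ^ l := Real.rpow_le_rpow_of_exponent_ge hR0 (inv_le_one_of_one_le₀ hR) hl1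
    _ ≤ _ := Real.rpow_le_rpow hR0.le h1 hl

/-- Total mass is conserved: if all other entries move in one direction, their total variation
equals the change at `i`. -/
theorem sum_abs_sub_le_two_mul {ι : Type*} [Fintype ι] [DecidableEq ι] {p q : ι → ℝ} {i : ι}
    (hsum : ∑ a, p a = ∑ a, q a)
    (hsign : (∀ j, j ≠ i → q j ≤ p j) ∨ ∀ j, j ≠ i → p j ≤ q j) :
    ∑ a, |q a - p a| ≤ 2 * |q i - p i| := by
  have h0 : (q i - p i) + ∑ a ∈ Finset.univ.erase i, (q a - p a) = 0 := by
    rw [Finset.add_sum_erase _ (fun a => q a - p a) (Finset.mem_univ i),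
      Finset.sum_sub_distrib, hsum, sub_self]
  have h1 : ∑ a ∈ Finset.univ.erase i, |q a - p a| ≤
      |∑ a ∈ Finset.univ.erase i, (q a - p a)| := by
    rcases hsign with h | h
    · rw [← abs_neg, ← Finset.sum_neg_distrib]
      refine le_trans (Finset.sum_le_sum fun a ha => ?_) (le_abs_self _)
      rw [abs_of_nonpos (by linarith [h a (Finset.ne_of_mem_erase ha)])]
    · refine le_trans (Finset.sum_le_sum fun a ha => ?_) (le_abs_self _)
      rw [abs_of_nonneg (by linarith [h a (Finset.ne_of_mem_erase ha)])]
  rw [← Finset.add_sum_erase _ _ (Finset.mem_univ i)]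
  have h2 : ∑ a ∈ Finset.univ.erase i, (q a - p a) = -(q i - p i) := by linarith
  rw [h2, abs_neg] at h1
  linarith

/-- A one-step bound for the moment of order `1 + l` of the likelihood ratio of two nearby laws
`p` and `q`: a discount factor `w` at `i` compensates their distance. -/
theorem sum_mul_div_rpow_mul_le {ι : Type*} [Fintype ι] [DecidableEq ι] {p q w : ι → ℝ} {i : ι}
    {R D s η l : ℝ} (hp : ∀ a, 0 ≤ p a) (hq : ∀ a, 0 ≤ q a) (hp1 : ∑ a, p a = 1)
    (hq1 : ∑ a, q a = 1) (hR : 1 ≤ R) (hD : 0 ≤ D) (hs : 0 ≤ s) (hs1 : s ≤ 1) (hη : 0 ≤ η)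
    (hpq : ∀ a, p a ≤ R * q a) (hqp : ∀ a, q a ≤ R * p a)
    (hd : ∀ a, |q a - p a| ≤ D * (s * p a + η))
    (hsign : (∀ j, j ≠ i → q j ≤ p j) ∨ ∀ j, j ≠ i → p j ≤ q j)
    (hl : 0 ≤ l) (hlR : 2 * l * R ^ 2 ≤ 1) (hlD : 8 * l * R ^ 3 * D ^ 2 ≤ 1)
    (hw : ∀ a, a ≠ i → w a = 1) (hwi : w i ≤ 1 - s ^ 2 / 2) :
    ∑ a, p a * (p a / q a) ^ l * w a ≤ 1 + (2 * D ^ 2 + Fintype.card ι * (R * D)) * η := by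
  have hlR1 : l * R ≤ 1 := by nlinarith
  have hl1 : l ≤ 1 := by nlinarith
  have hsq : ∀ a, (q a - p a) ^ 2 / p a ≤ D * s * |q a - p a| + R * D * η := fun a => by
    rcases (hp a).eq_or_lt with h | h
    · rw [← h]
      simp only [div_zero]
      positivity
    · rw [div_le_iff₀ h, ← sq_abs]
      have h1 := mul_le_mul_of_nonneg_left (hd a) (abs_nonneg (q a - p a))
      have h2 : |q a - p a| ≤ R * p a := by
        have := mul_le_mul_of_nonneg_right hR h.le
        rw [abs_le]
        constructor <;> linarith [hq a, hqp a]
      have h3 := mul_le_mul_of_nonneg_right h2 (mul_nonneg hD hη)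
      nlinarith
  -- One factor |q - p| costs s, and the sum of the other costs s p_i by the sign condition; this
  -- produces s² p_i instead of s².
  have hS : ∑ a, (q a - p a) ^ 2 / p a ≤
      2 * D ^ 2 * s ^ 2 * p i + (2 * D ^ 2 + Fintype.card ι * (R * D)) * η := by
    calc ∑ a, (q a - p a) ^ 2 / p a ≤ ∑ a, (D * s * |q a - p a| + R * D * η) :=
          Finset.sum_le_sum fun a _ => hsq a
      _ = D * s * ∑ a, |q a - p a| + Fintype.card ι * (R * D * η) := by
          rw [Finset.sum_add_distrib, ← Finset.mul_sum]
          simp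
      _ ≤ D * s * (2 * (D * (s * p i + η))) + Fintype.card ι * (R * D * η) := by
          gcongr
          exact (sum_abs_sub_le_two_mul (hp1.trans hq1.symm) hsign).trans
            (by linarith [hd i])
      _ ≤ _ := by
          have : s * (D ^ 2 * η) ≤ 1 * (D ^ 2 * η) := by gcongr
          nlinarith
  have hdisc : p i / R * (s ^ 2 / 2) ≤ p i * (p i / q i) ^ l * (1 - w i) :=
    mul_le_mul (div_le_mul_div_rpow (hp i) (hq i) hR (hpq i) (hqp i) hl hl1) (by linarith)
      (by positivity) (mul_nonneg (hp i) (Real.rpow_nonneg (div_nonneg (hp i) (hq i)) _))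
  -- The second-order loss is at most the saving from the discount; this is what the smallness of 8
  -- l R³ D² is for.
  have hdisc' : 2 * l * R ^ 2 * (2 * D ^ 2 * s ^ 2 * p i) ≤ p i / R * (s ^ 2 / 2) := by
    have hR0 : 0 < R := by linarith
    rw [div_mul_eq_mul_div, le_div_iff₀ hR0]
    have := mul_le_mul_of_nonneg_right hlD (mul_nonneg (hp i) (by positivity : 0 ≤ s ^ 2 / 2))
    nlinarith
  have hsplit : ∑ a, p a * (p a / q a) ^ l * w a =
      ∑ a, p a * (p a / q a) ^ l - p i * (p i / q i) ^ l * (1 - w i) := by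
    have h1 : ∑ a, p a * (p a / q a) ^ l * (1 - w a) = p i * (p i / q i) ^ l * (1 - w i) :=
      Finset.sum_eq_single i (fun a _ ha => by rw [hw a ha, sub_self, mul_zero]) (by simp)
    rw [← h1, ← Finset.sum_sub_distrib]
    exact Finset.sum_congr rfl fun a _ => by ring
  have hupper : ∑ a, p a * (p a / q a) ^ l ≤ 1 + 2 * l * R ^ 2 * ∑ a, (q a - p a) ^ 2 / p a := by
    calc ∑ a, p a * (p a / q a) ^ l
        ≤ ∑ a, (p a - l * (q a - p a) + 2 * l * R ^ 2 * ((q a - p a) ^ 2 / p a)) :=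
          Finset.sum_le_sum fun a _ => mul_div_rpow_le (hp a) (hq a) hR (hpq a) (hqp a) hl hlR1
      _ = _ := by
          rw [Finset.sum_add_distrib, Finset.sum_sub_distrib, ← Finset.mul_sum, ← Finset.mul_sum,
            Finset.sum_sub_distrib, hp1, hq1]
          ring
  have hη' : 0 ≤ (2 * D ^ 2 + Fintype.card ι * (R * D)) * η := by positivity
  have h1 := mul_le_mul_of_nonneg_left hS (by positivity : 0 ≤ 2 * l * R ^ 2)
  have h2 := mul_le_mul_of_nonneg_right hlR hη'
  rw [hsplit]
  linarith

/-! ### Laws of action sequences: moment growth and Markov's inequality. -/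

theorem PMF.sum_toReal_eq_one {α : Type*} [Fintype α] (p : PMF α) : ∑ a, (p a).toReal = 1 := by
  rw [← ENNReal.toReal_sum fun a _ => p.apply_ne_top a, ← tsum_fintype (L := .unconditional α),
    p.tsum_coe, ENNReal.toReal_one]

theorem PMF.toMeasure_eq_ofReal_sum {α : Type*} [Fintype α] [MeasurableSpace α]
    [MeasurableSingletonClass α] (p : PMF α) (S : Set α) [DecidablePred (· ∈ S)] :
    p.toMeasure S = ENNReal.ofReal (∑ a with a ∈ S, (p a).toReal) := by
  rw [p.toMeasure_apply_fintype S,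
    ← ENNReal.toReal_sum fun a _ => p.apply_ne_top a, ENNReal.ofReal_toReal
    (ENNReal.sum_ne_top.2 fun a _ => p.apply_ne_top a), Finset.sum_filter]
  exact Finset.sum_congr rfl fun a _ => by simp [Set.indicator]

namespace BanditAlgorithm

variable {K : ℕ} (A : BanditAlgorithm K)

/-- The law of the next arm after the actions `a`, for the reward table `r`. -/
def nextArm (r : ℕ → Fin K → ℝ) {t : ℕ} (a : Fin t → Fin K) (j : Fin K) : ℝ :=
  (A.policy t (fun s => (a s, r s (a s))) j).toReal

theorem nextArm_nonneg (r : ℕ → Fin K → ℝ) {t : ℕ} (a : Fin t → Fin K) (j : Fin K) :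
    0 ≤ A.nextArm r a j := ENNReal.toReal_nonneg

theorem sum_nextArm (r : ℕ → Fin K → ℝ) {t : ℕ} (a : Fin t → Fin K) :
    ∑ j, A.nextArm r a j = 1 := PMF.sum_toReal_eq_one _

theorem actions_succ_snoc_toReal (r : ℕ → Fin K → ℝ) {t : ℕ} (a : Fin t → Fin K) (j : Fin K) :
    (A.actions r (t + 1) (Fin.snoc (α := fun _ => Fin K) a j)).toReal =
      (A.actions r t a).toReal * A.nextArm r a j := by
  rw [actions, PMF.bind_apply, nextArm, ← ENNReal.toReal_mul]
  congr 1
  rw [tsum_eq_single a]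
  · congr 1
    rw [PMF.map_apply, tsum_eq_single j]
    · simp
    · intro j' hj'
      rw [if_neg]
      intro h
      exact hj' (Fin.snoc_inj.1 h).2.symm
  · intro a' ha'
    rw [PMF.map_apply]
    convert mul_zero _
    refine ENNReal.tsum_eq_zero.2 fun j' => if_neg fun h => ha' (Fin.snoc_inj.1 h).1.symm

theorem sum_snoc {t : ℕ} (f : (Fin (t + 1) → Fin K) → ℝ) :
    ∑ b, f b = ∑ a : Fin t → Fin K, ∑ j, f (Fin.snoc (α := fun _ => Fin K) a j) := by
  rw [← (Fin.snocEquiv fun _ => Fin K).sum_comp, Fintype.sum_prod_type_right]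
  rfl

variable {A} {r r' : ℕ → Fin K → ℝ}

theorem actions_toReal_eq_zero
    (h : ∀ t (a : Fin t → Fin K) j, A.nextArm r' a j = 0 → A.nextArm r a j = 0) (t : ℕ)
    (a : Fin t → Fin K) (ha : (A.actions r' t a).toReal = 0) : (A.actions r t a).toReal = 0 := by
  induction t with
  | zero =>
    have e : a = Fin.elim0 := Subsingleton.elim _ _
    simp [actions, e] at ha
  | succ t ih =>
    rw [← Fin.snoc_init_self (α := fun _ => Fin K) a] at ha ⊢
    rw [actions_succ_snoc_toReal, mul_eq_zero] at ha ⊢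
    exact ha.imp (ih _) (h _ _ _)

/-- The likelihood ratio is a product over rounds, so conditioning on the past makes the weighted
moment a supermartingale up to the factor 1 + c. -/
theorem sum_actions_mul_rpow_le {W : ∀ t, (Fin t → Fin K) → ℝ} {l c : ℝ}
    (hc : 0 ≤ c) (hW0 : ∀ a, W 0 a ≤ 1)
    (hstep : ∀ t (a : Fin t → Fin K),
      ∑ j, A.nextArm r a j * (A.nextArm r a j / A.nextArm r' a j) ^ l *
        W (t + 1) (Fin.snoc (α := fun _ => Fin K) a j) ≤ (1 + c) * W t a) (t : ℕ) :
    ∑ a, (A.actions r t a).toReal * ((A.actions r t a).toReal / (A.actions r' t a).toReal) ^ l *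
      W t a ≤ (1 + c) ^ t := by
  induction t with
  | zero =>
    rw [Fintype.sum_unique]
    have e : (default : Fin 0 → Fin K) = Fin.elim0 := Subsingleton.elim _ _
    simpa [actions, e] using hW0 _
  | succ t ih =>
    rw [sum_snoc, pow_succ']
    refine le_trans ?_ (mul_le_mul_of_nonneg_left ih (by linarith))
    rw [Finset.mul_sum]
    refine Finset.sum_le_sum fun a _ => ?_
    have hP : 0 ≤ (A.actions r t a).toReal := ENNReal.toReal_nonneg
    have hP' : 0 ≤ (A.actions r' t a).toReal := ENNReal.toReal_nonneg
    calc _ = (A.actions r t a).toReal *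
          ((A.actions r t a).toReal / (A.actions r' t a).toReal) ^ l *
          ∑ j, A.nextArm r a j * (A.nextArm r a j / A.nextArm r' a j) ^ l *
            W (t + 1) (Fin.snoc (α := fun _ => Fin K) a j) := by
          rw [Finset.mul_sum]
          refine Finset.sum_congr rfl fun j _ => ?_
          rw [actions_succ_snoc_toReal, actions_succ_snoc_toReal, mul_div_mul_comm,
            Real.mul_rpow (div_nonneg hP hP')
              (div_nonneg (A.nextArm_nonneg r a j) (A.nextArm_nonneg r' a j))]
          ring
      _ ≤ (A.actions r t a).toReal *
          ((A.actions r t a).toReal / (A.actions r' t a).toReal) ^ l * ((1 + c) * W t a) := by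
          gcongr
          exact hstep t a
      _ = _ := by ring

/-- Markov's inequality: where P > e^ε P', the weighted ratio is at least e^{lε} w. Absolute
continuity is required because P / 0 is 0, so the moment would not see sequences with P' = 0. -/
theorem toMeasure_actions_le {T : ℕ} {W : (Fin T → Fin K) → ℝ} {l w M ε δ : ℝ} (hl : 0 ≤ l)
    (hw : 0 < w) (hW : ∀ a, w ≤ W a)
    (hac : ∀ a, (A.actions r' T a).toReal = 0 → (A.actions r T a).toReal = 0)
    (hM : ∑ a, (A.actions r T a).toReal *
      ((A.actions r T a).toReal / (A.actions r' T a).toReal) ^ l * W a ≤ M)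
    (hδ : M ≤ Real.exp (l * ε) * w * δ) (S : Set (Fin T → Fin K)) :
    (A.actions r T).toMeasure S ≤
      ENNReal.ofReal (Real.exp ε) * (A.actions r' T).toMeasure S + ENNReal.ofReal δ := by
  classical
  set P := fun a => (A.actions r T a).toReal with hP
  set P' := fun a => (A.actions r' T a).toReal with hP'
  have hP0 : ∀ a, 0 ≤ P a := fun a => ENNReal.toReal_nonneg
  have hP0' : ∀ a, 0 ≤ P' a := fun a => ENNReal.toReal_nonneg
  set E := Real.exp (l * ε) * w with hE
  have hE0 : 0 < E := by positivity
  have hterm : ∀ a, 0 ≤ P a * (P a / P' a) ^ l * W a := fun a =>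
    mul_nonneg (mul_nonneg (hP0 a) (Real.rpow_nonneg (div_nonneg (hP0 a) (hP0' a)) _))
      (hw.le.trans (hW a))
  have hM0 : 0 ≤ M := le_trans (Finset.sum_nonneg fun a _ => hterm a) hM
  have hδ0 : 0 ≤ δ := nonneg_of_mul_nonneg_right (hM0.trans hδ) hE0
  have hpt : ∀ a, P a ≤ Real.exp ε * P' a + P a * (P a / P' a) ^ l * W a / E := fun a => by
    by_cases h : P a ≤ Real.exp ε * P' a
    · have := div_nonneg (hterm a) hE0.le
      linarith
    · push Not at h
      have hp : 0 < P' a := by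
        refine (hP0' a).lt_of_ne fun h0 => ?_
        have := hac a h0.symm
        rw [← h0] at h
        simp only [mul_zero] at h
        exact h.ne' this
      have h1 : Real.exp (l * ε) ≤ (P a / P' a) ^ l := by
        rw [mul_comm, Real.exp_mul]
        refine Real.rpow_le_rpow (Real.exp_pos _).le ?_ hl
        rw [le_div_iff₀ hp]
        exact h.le
      have h2 : P a ≤ P a * (P a / P' a) ^ l * W a / E := by
        rw [le_div_iff₀ hE0, hE, mul_assoc]
        exact mul_le_mul_of_nonneg_left (mul_le_mul h1 (hW a) hw.le
          (Real.rpow_nonneg (div_nonneg (hP0 a) (hP0' a)) _)) (hP0 a)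
      have := mul_nonneg (Real.exp_pos ε).le (hP0' a)
      linarith
  have hsum : ∑ a with a ∈ S, P a ≤ Real.exp ε * ∑ a with a ∈ S, P' a + δ := by
    calc ∑ a with a ∈ S, P a
        ≤ ∑ a with a ∈ S, (Real.exp ε * P' a + P a * (P a / P' a) ^ l * W a / E) :=
          Finset.sum_le_sum fun a _ => hpt a
      _ = Real.exp ε * ∑ a with a ∈ S, P' a +
          (∑ a with a ∈ S, P a * (P a / P' a) ^ l * W a) / E := by
          rw [Finset.sum_add_distrib, Finset.mul_sum, Finset.sum_div]
      _ ≤ _ := by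
          gcongr
          rw [div_le_iff₀' hE0]
          refine le_trans ?_ (hM.trans hδ)
          exact Finset.sum_le_sum_of_subset_of_nonneg (Finset.subset_univ _) fun a _ _ => hterm a
  rw [PMF.toMeasure_eq_ofReal_sum, PMF.toMeasure_eq_ofReal_sum,
    ← ENNReal.ofReal_mul (Real.exp_pos _).le, ← ENNReal.ofReal_add
      (mul_nonneg (Real.exp_pos _).le (Finset.sum_nonneg fun a _ => hP0' a)) hδ0]
  exact ENNReal.ofReal_le_ofReal hsum

end BanditAlgorithm

/-! ### Thompson Sampling on two tables differing in one round. -/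

/-- The number of times that the arm `i` occurs among the actions `a`. -/
def armCount {K t : ℕ} (a : Fin t → Fin K) (i : Fin K) : ℕ :=
  (Finset.univ.filter fun s => a s = i).card

theorem armCount_le {K t : ℕ} (a : Fin t → Fin K) (i : Fin K) : armCount a i ≤ t := by
  simpa [armCount] using Finset.card_le_univ (Finset.univ.filter fun s => a s = i)

theorem one_le_armCount {K t : ℕ} (a : Fin t → Fin K) (s : Fin t) : 1 ≤ armCount a (a s) :=
  Finset.card_pos.2 ⟨s, by simp⟩

theorem armCount_snoc {K t : ℕ} (a : Fin t → Fin K) (i j : Fin K) :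
    armCount (Fin.snoc (α := fun _ => Fin K) a j) i = armCount a i + if j = i then 1 else 0 := by
  simp only [armCount, Finset.card_filter, Fin.sum_univ_castSucc, Fin.snoc_castSucc, Fin.snoc_last]

theorem harmonic_sub_one_le {n T : ℕ} (hnT : n ≤ T) :
    (harmonic (n - 1) : ℝ) ≤ 1 + Real.log T := by
  refine (harmonic_le_one_add_log _).trans ?_
  rcases Nat.eq_zero_or_pos (n - 1) with h | h
  · rw [h]
    simpa using Real.log_natCast_nonneg T
  · have : ((n - 1 : ℕ) : ℝ) ≤ T := by exact_mod_cast (Nat.sub_le n 1).trans hnT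
    have := Real.log_le_log (by exact_mod_cast h) this
    linarith

section history

variable {K t : ℕ} (m : MeanRule) {h : Fin t → Fin K × ℝ}

theorem rewardSum_mem_Icc (hr : ∀ s, (h s).2 ∈ Set.Icc (0 : ℝ) 1) (i : Fin K) :
    rewardSum h i ∈ Set.Icc (0 : ℝ) (pulls h i) := by
  refine ⟨Finset.sum_nonneg fun s _ => (hr s).1, ?_⟩
  refine (Finset.sum_le_sum fun s _ => (hr s).2).trans ?_
  simp [pulls]

theorem armMean_mem_Icc (hr : ∀ s, (h s).2 ∈ Set.Icc (0 : ℝ) 1) (i : Fin K) :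
    armMean m h i ∈ Set.Icc (0 : ℝ) 1 := by
  obtain ⟨h0, h1⟩ := rewardSum_mem_Icc hr i
  cases m with
  | posterior =>
    simp only [armMean]
    exact ⟨by positivity, by rw [div_le_one (by positivity)]; linarith⟩
  | empirical =>
    simp only [armMean]
    split_ifs with hk
    · simp
    · have : (0 : ℝ) < pulls h i := by positivity
      exact ⟨by positivity, by rw [div_le_one this]; exact h1⟩

/-- The factor 2 is for the empirical mean, where 1/k ≤ 2/(k+1) needs a previous play. -/
theorem abs_armMean_sub_le {h' : Fin t → Fin K × ℝ} {i : Fin K} (hp : pulls h' i = pulls h i)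
    (hk : 1 ≤ pulls h i) (hd : |rewardSum h' i - rewardSum h i| ≤ 1) :
    |armMean m h' i - armMean m h i| ≤ 2 * ((pulls h i : ℝ) + 1)⁻¹ := by
  have hk' : (1 : ℝ) ≤ pulls h i := by exact_mod_cast hk
  cases m with
  | posterior =>
    simp only [armMean, hp]
    rw [← sub_div, abs_div, abs_of_pos (by positivity : (0 : ℝ) < pulls h i + 1), div_eq_mul_inv]
    gcongr
    linarith
  | empirical =>
    simp only [armMean, hp]
    rw [if_neg (by omega), if_neg (by omega), ← sub_div, abs_div,
      abs_of_pos (by positivity : (0 : ℝ) < pulls h i), ← div_eq_mul_inv,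
      div_le_div_iff₀ (by positivity) (by positivity)]
    nlinarith

end history

section tables

variable {K : ℕ} {r r' : ℕ → Fin K → ℝ} {s t : ℕ}

theorem abs_rewardSum_sub_le (hr : ∀ t i, r t i ∈ Set.Icc (0 : ℝ) 1)
    (hr' : ∀ t i, r' t i ∈ Set.Icc (0 : ℝ) 1) (hd : ∀ t, t ≠ s → r t = r' t)
    (hst : s < t) (a : Fin t → Fin K) :
    |rewardSum (fun u => (a u, r' u (a u))) (a ⟨s, hst⟩) -
      rewardSum (fun u => (a u, r u (a u))) (a ⟨s, hst⟩)| ≤ 1 := by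
  simp only [rewardSum]
  rw [← Finset.sum_sub_distrib, Finset.sum_eq_single (⟨s, hst⟩ : Fin t)]
  · have h1 := hr s (a ⟨s, hst⟩)
    have h2 := hr' s (a ⟨s, hst⟩)
    rw [abs_le]
    constructor <;> linarith [h1.1, h1.2, h2.1, h2.2]
  · intro u _ hu
    rw [hd u fun h => hu (Fin.ext h), sub_self]
  · intro h
    simp at h

theorem armMean_congr (m : MeanRule) (hd : ∀ t, t ≠ s → r t = r' t)
    (hst : s < t) (a : Fin t → Fin K) {j : Fin K} (hj : j ≠ a ⟨s, hst⟩) :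
    armMean m (fun u => (a u, r' u (a u))) j = armMean m (fun u => (a u, r u (a u))) j := by
  have h1 : rewardSum (fun u => (a u, r' u (a u))) j = rewardSum (fun u => (a u, r u (a u))) j := by
    refine Finset.sum_congr rfl fun u hu => ?_
    have hu : a u = j := (Finset.mem_filter.1 hu).2
    simp only
    rw [hd u fun h => hj ?_]
    rw [← hu]
    exact congrArg a (Fin.ext h)
  have h2 : pulls (fun u => (a u, r' u (a u))) j = pulls (fun u => (a u, r u (a u))) j := rfl
  cases m <;> simp only [armMean, h1, h2]

theorem coe_inv_natCast_add_one (k : ℕ) : (((k : NNReal) + 1)⁻¹ : NNReal) = ((k : ℝ) + 1)⁻¹ := by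
  push_cast
  rfl

theorem inv_natCast_add_one_le_one (k : ℕ) : ((k : NNReal) + 1)⁻¹ ≤ 1 :=
  inv_le_one_of_one_le₀ (by simp)

theorem inv_natCast_add_one_ne_zero (k : ℕ) : ((k : NNReal) + 1)⁻¹ ≠ 0 := by positivity

theorem shiftedMarginals_history (m : MeanRule) (hr : ∀ t i, r t i ∈ Set.Icc (0 : ℝ) 1)
    (hr' : ∀ t i, r' t i ∈ Set.Icc (0 : ℝ) 1) (hd : ∀ t, t ≠ s → r t = r' t)
    (hst : s < t) (a : Fin t → Fin K) :
    ShiftedMarginals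
      (fun i => gaussianReal (armMean m (fun u => (a u, r u (a u))) i)
        ((armCount a i : NNReal) + 1)⁻¹)
      (fun i => gaussianReal (armMean m (fun u => (a u, r' u (a u))) i)
        ((armCount a i : NNReal) + 1)⁻¹)
      (a ⟨s, hst⟩) (armMean m (fun u => (a u, r u (a u))) (a ⟨s, hst⟩))
      (armMean m (fun u => (a u, r' u (a u))) (a ⟨s, hst⟩))
      ((armCount a (a ⟨s, hst⟩) : NNReal) + 1)⁻¹ where
  left_eq := rfl
  right_eq := rfl
  eq_of_ne j hj := by rw [armMean_congr m hd hst a hj]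
  half_left j :=
    have h := armMean_mem_Icc m (h := fun u => (a u, r u (a u))) (fun u => hr u (a u)) j
    ⟨half_le_gaussianReal_Iio (inv_natCast_add_one_ne_zero _) (inv_natCast_add_one_le_one _) h.2,
      half_le_gaussianReal_Ioi (inv_natCast_add_one_ne_zero _) (inv_natCast_add_one_le_one _) h.1⟩
  half_right j :=
    have h := armMean_mem_Icc m (h := fun u => (a u, r' u (a u))) (fun u => hr' u (a u)) j
    ⟨half_le_gaussianReal_Iio (inv_natCast_add_one_ne_zero _) (inv_natCast_add_one_le_one _) h.2,
      half_le_gaussianReal_Ioi (inv_natCast_add_one_ne_zero _) (inv_natCast_add_one_le_one _) h.1⟩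
  left_mem := armMean_mem_Icc m (fun u => hr u (a u)) _
  right_mem := armMean_mem_Icc m (fun u => hr' u (a u)) _
  var_ne_zero := inv_natCast_add_one_ne_zero _
  var_le := inv_natCast_add_one_le_one _
  dist_le := by
    rw [coe_inv_natCast_add_one]
    exact abs_armMean_sub_le m (h := fun u => (a u, r u (a u))) rfl (one_le_armCount a ⟨s, hst⟩)
      (abs_rewardSum_sub_le hr hr' hd hst a)

theorem nextArm_congr (A : BanditAlgorithm K) (hd : ∀ t, t ≠ s → r t = r' t) (hts : t ≤ s)
    (a : Fin t → Fin K) (j : Fin K) : A.nextArm r' a j = A.nextArm r a j := by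
  have : ∀ u : Fin t, r u = r' u := fun u => hd u (by omega)
  simp only [BanditAlgorithm.nextArm, this]

/-! ### The discount and the moment growth per round. -/

/-- The discount that pays for the privacy loss: from the round `s` of the changed reward on, each
further play number `k + 1` of the arm played there costs `exp (-L / k)`. -/
def discount (s : ℕ) (L : ℝ) {K : ℕ} (t : ℕ) (a : Fin t → Fin K) : ℝ :=
  if h : s < t then Real.exp (-(L * harmonic (armCount a (a ⟨s, h⟩) - 1))) else 1

theorem discount_le_one {L : ℝ} (hL : 0 ≤ L) (a : Fin t → Fin K) : discount s L t a ≤ 1 := by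
  unfold discount
  split_ifs with h
  · rw [Real.exp_le_one_iff, neg_nonpos]
    refine mul_nonneg hL ?_
    exact_mod_cast Finset.sum_nonneg fun i _ => by positivity
  · exact le_rfl

theorem le_discount {T : ℕ} (a : Fin T → Fin K) :
    Real.exp (-(Real.log T * (1 + Real.log T))) ≤ discount s (Real.log T) T a := by
  have hL : 0 ≤ Real.log T := Real.log_natCast_nonneg T
  unfold discount
  split_ifs with h
  · rw [Real.exp_le_exp, neg_le_neg_iff]
    exact mul_le_mul_of_nonneg_left (harmonic_sub_one_le (armCount_le a _)) hL
  · rw [Real.exp_le_one_iff, neg_nonpos]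
    positivity

theorem discount_snoc (L : ℝ) (hst : s < t) (a : Fin t → Fin K) (j : Fin K) :
    discount s L (t + 1) (Fin.snoc (α := fun _ => Fin K) a j) =
      (if j = a ⟨s, hst⟩ then Real.exp (-(L / armCount a (a ⟨s, hst⟩))) else 1) *
        discount s L t a := by
  have hs : Fin.snoc (α := fun _ => Fin K) a j ⟨s, hst.trans (Nat.lt_succ_self t)⟩ = a ⟨s, hst⟩ :=
    Fin.snoc_castSucc (α := fun _ => Fin K) j a ⟨s, hst⟩
  unfold discount
  rw [dif_pos (hst.trans (Nat.lt_succ_self t)), dif_pos hst, hs, armCount_snoc]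
  split_ifs with hj
  -- The play in round `s` itself makes the count positive, so the truncated subtraction is a true
  -- one.
  · obtain ⟨n, hn⟩ := Nat.exists_eq_add_of_le' (one_le_armCount a ⟨s, hst⟩)
    rw [hn, Nat.add_sub_cancel, Nat.add_sub_cancel, harmonic_succ, ← Real.exp_add]
    push_cast
    ring_nf
  · rw [add_zero, one_mul]

variable [NeZero K]

theorem thompsonSampling_nextArm (m : MeanRule) (r : ℕ → Fin K → ℝ) (a : Fin t → Fin K)
    (j : Fin K) :
    (thompsonSampling m K).nextArm r a j = (Measure.pi fun i => gaussianReal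
      (armMean m (fun u => (a u, r u (a u))) i) ((armCount a i : NNReal) + 1)⁻¹).real
        (argmax ⁻¹' {j}) := by
  simp only [BanditAlgorithm.nextArm, thompsonSampling]
  rw [Measure.toPMF_apply, Measure.map_apply measurable_argmax (measurableSet_singleton j)]
  rfl

theorem thompsonSampling_nextArm_le (m : MeanRule) (hr : ∀ t i, r t i ∈ Set.Icc (0 : ℝ) 1)
    (hr' : ∀ t i, r' t i ∈ Set.Icc (0 : ℝ) 1) (hd : ∀ t, t ≠ s → r t = r' t)
    (a : Fin t → Fin K) (j : Fin K) :
    (thompsonSampling m K).nextArm r' a j ≤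
      ratioBound K * (thompsonSampling m K).nextArm r a j := by
  rcases Nat.lt_or_ge s t with hst | hst
  · rw [thompsonSampling_nextArm, thompsonSampling_nextArm]
    exact (shiftedMarginals_history m hr hr' hd hst a).right_real_le_ratioBound_mul j
  · rw [nextArm_congr _ hd hst]
    exact le_mul_of_one_le_left (BanditAlgorithm.nextArm_nonneg _ _ _ _) (one_le_ratioBound K)

/-- The order, minus one, of the moments of the likelihood ratio. -/
def momentOrder (K : ℕ) : ℝ :=
  (8 * ratioBound K ^ 3 * (6 * Real.exp 6 * ratioBound K) ^ 2)⁻¹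

/-- The constant in the growth rate of the moments of the likelihood ratio. -/
def momentRate (K : ℕ) : ℝ :=
  2 * (6 * Real.exp 6 * ratioBound K) ^ 2 + K * (ratioBound K * (6 * Real.exp 6 * ratioBound K))

theorem momentOrder_pos (K : ℕ) : 0 < momentOrder K := by
  have := one_le_ratioBound K
  unfold momentOrder
  positivity

theorem momentRate_nonneg (K : ℕ) : 0 ≤ momentRate K := by
  have := one_le_ratioBound K
  unfold momentRate
  positivity

theorem exp_neg_le_one_sub_half {y x : ℝ} (hx0 : 0 ≤ x) (hx1 : x ≤ 1) (hxy : x ≤ y) :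
    Real.exp (-y) ≤ 1 - x / 2 := by
  have h1 : Real.exp (-y) ≤ Real.exp (-x) := Real.exp_le_exp.2 (by linarith)
  have h2 : Real.exp (-x) ≤ (1 + x)⁻¹ := by
    rw [Real.exp_neg]
    exact inv_anti₀ (by linarith) (by linarith [Real.add_one_le_exp x])
  have h3 : (1 + x)⁻¹ ≤ 1 - x / 2 := by
    rw [inv_le_iff_one_le_mul₀ (by linarith)]
    nlinarith
  linarith

theorem sum_nextArm_mul_discount_le (m : MeanRule) (hr : ∀ t i, r t i ∈ Set.Icc (0 : ℝ) 1)
    (hr' : ∀ t i, r' t i ∈ Set.Icc (0 : ℝ) 1) (hd : ∀ t, t ≠ s → r t = r' t) {T : ℕ}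
    (hT : 2 ≤ T) (a : Fin t → Fin K) :
    ∑ j, (thompsonSampling m K).nextArm r a j *
      ((thompsonSampling m K).nextArm r a j / (thompsonSampling m K).nextArm r' a j) ^
        momentOrder K *
      discount s (Real.log T) (t + 1) (Fin.snoc (α := fun _ => Fin K) a j) ≤
      (1 + momentRate K * (T : ℝ)⁻¹) * discount s (Real.log T) t a := by
  set A := thompsonSampling m K with hA
  have hL : 0 ≤ Real.log T := Real.log_natCast_nonneg T
  have hR := one_le_ratioBound K
  have hl := momentOrder_pos K
  have hd' : ∀ t, t ≠ s → r' t = r t := fun t ht => (hd t ht).symm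
  have hd0 : 0 ≤ discount s (Real.log T) t a := by
    unfold discount; split_ifs <;> positivity
  rcases Nat.lt_or_ge s t with hst | hst
  · obtain ⟨σ, hσ0, hσ1, hσ2, hσ⟩ := (shiftedMarginals_history m hr hr' hd hst a).exists_abs_sub_le
      (one_le_armCount a ⟨s, hst⟩) (coe_inv_natCast_add_one _) hT
    simp only [← thompsonSampling_nextArm] at hσ
    have h6 : 1 ≤ Real.exp 6 := Real.one_le_exp (by norm_num)
    have hcoef : 8 * momentOrder K * ratioBound K ^ 3 * (6 * Real.exp 6 * ratioBound K) ^ 2 = 1 := by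
      unfold momentOrder
      field_simp
    have hcoef' : 2 * momentOrder K * ratioBound K ^ 2 ≤ 1 := by
      rw [← hcoef]
      have h1 : 1 ≤ 4 * ratioBound K * (6 * Real.exp 6 * ratioBound K) ^ 2 := by
        have : 1 ≤ 6 * Real.exp 6 * ratioBound K := by nlinarith
        nlinarith [one_le_pow₀ this (n := 2)]
      have h2 : 0 ≤ 2 * momentOrder K * ratioBound K ^ 2 := by positivity
      nlinarith
    have key := sum_mul_div_rpow_mul_le (p := A.nextArm r a) (q := A.nextArm r' a)
      (w := fun j => if j = a ⟨s, hst⟩ then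
        Real.exp (-(Real.log T / armCount a (a ⟨s, hst⟩))) else 1)
      (i := a ⟨s, hst⟩) (R := ratioBound K) (D := 6 * Real.exp 6 * ratioBound K) (s := σ)
      (η := (T : ℝ)⁻¹) (l := momentOrder K) (A.nextArm_nonneg r a) (A.nextArm_nonneg r' a)
      (A.sum_nextArm r a) (A.sum_nextArm r' a) hR (by positivity) hσ0 hσ1 (by positivity)
      (thompsonSampling_nextArm_le m hr' hr hd' a) (thompsonSampling_nextArm_le m hr hr' hd a) hσ
      (by
        simp only [hA, thompsonSampling_nextArm]
        rcases le_total (armMean m (fun u => (a u, r u (a u))) (a ⟨s, hst⟩))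
          (armMean m (fun u => (a u, r' u (a u))) (a ⟨s, hst⟩)) with h | h
        · exact Or.inl fun j hj =>
            (shiftedMarginals_history m hr hr' hd hst a).right_real_le_left_real h hj
        -- When the center moves down, the same monotonicity is used with the tables exchanged.
        · exact Or.inr fun j hj =>
            (shiftedMarginals_history m hr' hr hd' hst a).right_real_le_left_real h hj)
      hl.le hcoef' hcoef.le (fun j hj => if_neg hj)
      (by
        rw [if_pos rfl]
        exact exp_neg_le_one_sub_half (by positivity) (pow_le_one₀ hσ0 hσ1) hσ2)
    rw [Fintype.card_fin] at key
    have := mul_le_mul_of_nonneg_right key hd0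
    rw [Finset.sum_mul] at this
    refine le_trans (le_of_eq (Finset.sum_congr rfl fun j _ => ?_)) this
    rw [discount_snoc _ hst, mul_assoc, mul_assoc, mul_assoc]
  -- Up to the changed round both tables give the same law, so the ratio is 1 and no loss occurs.
  · have h1 : discount s (Real.log T) t a = 1 := dif_neg (by omega)
    rw [h1, mul_one]
    have hpos : 0 ≤ momentRate K * (T : ℝ)⁻¹ := mul_nonneg (momentRate_nonneg K) (by positivity)
    refine le_trans (Finset.sum_le_sum (g := A.nextArm r a) fun j _ => ?_)
      (by rw [A.sum_nextArm]; linarith)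
    rw [nextArm_congr A hd hst]
    have hp := A.nextArm_nonneg r a j
    rcases hp.eq_or_lt with h0 | h0
    · simp [← h0]
    · rw [div_self h0.ne', Real.one_rpow, mul_one]
      exact mul_le_of_le_one_right hp (discount_le_one hL _)

end tables

end

/-! ### Choice of the constants. -/

theorem theorem1 (m : MeanRule) (K : ℕ) [NeZero K] :
    ∃ C : ℝ, 0 < C ∧ ∀ T : ℕ, 1 ≤ T →
      (thompsonSampling m K).IsDifferentiallyPrivate T
        (C * Real.log T ^ 2) (C * ((T : ℝ) ^ 4)⁻¹) := by
  have hl := momentOrder_pos K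
  have hB := momentRate_nonneg K
  have hexpB := Real.one_le_exp hB
  -- The first summand bounds the moment after T rounds. With L = ln T, the 11 gives 11L² ≥ L(1 + L)
  -- + 4L, which holds as soon as L ≥ 1/2.
  refine ⟨Real.exp (momentRate K) + 11 / momentOrder K, by positivity, fun T hT => ?_⟩
  set C := Real.exp (momentRate K) + 11 / momentOrder K with hC
  have hC1 : Real.exp (momentRate K) ≤ C := by
    rw [hC]
    have : 0 ≤ 11 / momentOrder K := by positivity
    linarith
  rintro r r' hr hr' ⟨s, hd⟩ S
  rcases hT.eq_or_lt with rfl | hT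
  -- For T = 1 the additive term is C ≥ 1 and there is nothing to prove.
  · refine le_trans prob_le_one (le_add_left ?_)
    rw [ENNReal.one_le_ofReal]
    norm_num
    linarith
  have hT0 : (2 : ℝ) ≤ T := by exact_mod_cast hT
  have hL : 1 / 2 < Real.log T :=
    lt_of_lt_of_le (by linarith [Real.log_two_gt_d9]) (Real.log_le_log two_pos hT0)
  have hd' : ∀ t, t ≠ s → r' t = r t := fun t ht => (hd t ht).symm
  refine BanditAlgorithm.toMeasure_actions_le hl.le (Real.exp_pos _)
    (fun a => le_discount (s := s) a)
    (BanditAlgorithm.actions_toReal_eq_zero (fun t a j h0 => ?_) T)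
    (BanditAlgorithm.sum_actions_mul_rpow_le
      (W := fun t a => discount s (Real.log T) t a) (c := momentRate K * (T : ℝ)⁻¹) (by positivity)
      (fun a => discount_le_one (by linarith) a)
      (fun t a => sum_nextArm_mul_discount_le m hr hr' hd hT a) T) ?_ S
  · have := thompsonSampling_nextArm_le m hr' hr hd' a j
    rw [h0, mul_zero] at this
    exact le_antisymm this (BanditAlgorithm.nextArm_nonneg _ _ _ _)
  · have h1 : (1 + momentRate K * (T : ℝ)⁻¹) ^ T ≤ Real.exp (momentRate K) := by
      calc (1 + momentRate K * (T : ℝ)⁻¹) ^ T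
          ≤ Real.exp (momentRate K * (T : ℝ)⁻¹) ^ T := by
            refine pow_le_pow_left₀ (by positivity) ?_ T
            rw [add_comm]
            exact Real.add_one_le_exp _
        _ = Real.exp (momentRate K) := by
            rw [← Real.exp_nat_mul]
            congr 1
            field_simp
    have h2 : ((T : ℝ) ^ 4)⁻¹ = Real.exp (-(4 * Real.log T)) := by
      rw [Real.exp_neg, mul_comm, Real.exp_mul, Real.exp_log (by linarith)]
      norm_cast
    have h3 : 11 * Real.log T ^ 2 ≤ momentOrder K * (C * Real.log T ^ 2) := by
      have : 11 ≤ momentOrder K * C := by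
        rw [hC, mul_add, mul_div_cancel₀ _ hl.ne']
        have := mul_pos hl (Real.exp_pos (momentRate K))
        linarith
      nlinarith [sq_nonneg (Real.log T)]
    have h4 : 1 ≤ Real.exp (momentOrder K * (C * Real.log T ^ 2)) *
        Real.exp (-(Real.log T * (1 + Real.log T))) * ((T : ℝ) ^ 4)⁻¹ := by
      rw [h2, ← Real.exp_add, ← Real.exp_add]
      refine Real.one_le_exp ?_
      nlinarith
    calc _ ≤ C * 1 := by rw [mul_one]; exact h1.trans hC1
      _ ≤ C * _ := mul_le_mul_of_nonneg_left h4 (by positivity)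
      _ = _ := by ring
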